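/- Let $n,m\ge 0$ and let $J^\infty=J^\infty(\mathbb R^n,\mathbb R^m)$ be the product of real lines with coordinates $x_i$ ($1\le i\le n$) and $y_L^\alpha$ ($1\le L\le m$, $\alpha\in\mathbb N^n$); for an integer $k\ge 0$, $J^k$ is the finite subproduct with coordinates $x_i$ and $y_L^\alpha$, $|\alpha|\le k$, and $\pi_k:J^\infty\to J^k$ is the projection. Write $D^i=\partial_{x_i}+\sum_{L,\alpha}y_L^{\alpha+i}\,\partial_{y_L^\alpha}$, where $\alpha+i$ is $\alpha$ with its $i$-th entry increased by one. For a set $A$ of pairs $(L,\alpha)$ put $|A|=\sup\{|\alpha|:(L,\alpha)\in A\}$. Let $V\subseteq J^k$ be open (for instance $V=J^k$) and $W=\pi_k^{-1}(V)$. Let $X=\sum_i\xi_i\,\partial_{x_i}+\sum_{L,\alpha}\eta_L^\alpha\,\partial_{y_L^\alpha}$ be a Lie–Bäcklund field on $W$: every component is a $C^\infty$ function of finitely many coordinates, and $\eta_L^{\alpha+i}=D^i\eta_L^\alpha-\sum_j y_L^{\alpha+j}D^i\xi_j$ on $W$ for all $L,\alpha,i$. Let $B$ be the set of all $(M,\beta)$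 for which $\partial\xi_i/\partial y_M^\beta\not\equiv 0$ for some $i$ or $\partial\eta_L^0/\partial y_M^\beta\not\equiv0$ for some $L$. Let $A$ be a finite set of pairs $(L,\alpha)$ with $A\supseteq B$, and suppose that $k=2|A|$. For $|\alpha|\le k$, $\eta^\alpha_L$ is a polynomial in the coordinates $y_M^\gamma$ with $|\gamma|>k$, whose coefficients are functions on $V$; let $\eta_L^{k\alpha}$ be its term of degree zero and, for each nonconstant monomial (numbered by $\ell$), let $c_{\ell L}^{k\alpha}$ be the coefficient of this monomial. Put, on $V$, $$X^{(k)}=\sum_i\xi_i\,\partial_{x_i}+\sum_{|\alpha|\le k,\,L}\eta_L^{k\alpha}\,\partial_{y_L^\alpha},\qquad Y_\ell^{(k)}=\sum_{|\alpha|\le k,\,L}c_{\ell L}^{k\alpha}\,\partial_{y_L^\alpha}.$$ Suppose that the maximal flow $\Phi_t^{(k)}$ of $X^{(k)}$ in $V$, with components $\Phi^{(k)}_{it}$ and $\Phi^{(k)\alpha}_{Lt}$, satisfies on its whole domain $$(\star)\qquad Y_\ell^{(k)}\Phi_{it}^{(k)}=0\quad(1\le i\le n),\qquad Y_\ell^{(k)}\Phi_{Lt}^{(k)\alpha}=0\quad(1\le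 L\le m,\ |\alpha|\le|A|)\qquad\text{for all }\ell.$$ Then $X$ is exponentiable on $W$: there is a local flow $\Phi_t$, whose every component $(\Phi_t)_\lambda$ is a $C^\infty$ function of $t$ and of finitely many coordinates (not depending on $t$), defined on an open set of values of these that contains, for each $z\in W$, the coordinates of $z$ together with $t=0$, such that for $z\in W$ one has $\Phi_0(z)=z$, $\frac{d}{dt}\big|_{t=0}(\Phi_t)_\lambda(z)$ is the component $\lambda$ of $X$ at $z$, and $(\Phi_t)_\lambda(\Phi_s(z))=(\Phi_{t+s})_\lambda(z)$ whenever both sides are defined. -/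

import Mathlib

open scoped ContDiff

noncomputable section

namespace LieBacklund

/-- A multipair `(L, α)`: an index `L` of a dependent variable and a multiindex `α`. -/
abbrev Multipair (n m : ℕ) : Type := Fin m × (Fin n → ℕ)

/-- The coordinates of `J^∞(ℝⁿ, ℝᵐ)`: `Sum.inl i` stands for `x_i` and `Sum.inr (L, α)` for
`y_L^α`. -/
abbrev Coord (n m : ℕ) : Type := Fin n ⊕ Multipair n m

/-- `J^∞(ℝⁿ, ℝᵐ)`, identified with the product of one real line for each coordinate. -/
abbrev Jet (n m : ℕ) : Type := Coord n m → ℝ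

/-- The length `|α|` of a multiindex. -/
def len {n : ℕ} (α : Fin n → ℕ) : ℕ := ∑ i, α i

/-- `|A| = sup { |α| : (L, α) ∈ A }` for a finite set `A` of multipairs. -/
def setOrder {n m : ℕ} (A : Finset (Multipair n m)) : ℕ := A.sup fun q => len q.2

/-- The order of a coordinate: `0` for `x_i` and `|α|` for `y_L^α`. -/
def coordOrder {n m : ℕ} : Coord n m → ℕ
  | Sum.inl _ => 0
  | Sum.inr q => len q.2

/-- The finite set of the coordinates of order at most `k`. -/
def lowCoords (n m k : ℕ) : Finset (Coord n m) :=
  (Finset.univ.disjSum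
    (Finset.univ ×ˢ Fintype.piFinset fun _ : Fin n => Finset.range (k + 1))).filter
      fun c => coordOrder c ≤ k

theorem mem_lowCoords {n m k : ℕ} {c : Coord n m} :
    c ∈ lowCoords n m k ↔ coordOrder c ≤ k := by
  unfold lowCoords
  rw [Finset.mem_filter]
  refine ⟨fun h => h.2, fun h => ⟨?_, h⟩⟩
  rcases c with i | ⟨L, α⟩
  · simp
  · simp only [Finset.inr_mem_disjSum, Finset.mem_product, Finset.mem_univ, true_and,
      Fintype.mem_piFinset, Finset.mem_range]
    intro i
    have h1 : α i ≤ len α := Finset.single_le_sum (fun j _ => Nat.zero_le (α j)) (Finset.mem_univ i)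
    have h2 : len α ≤ k := h
    omega

/-- The finite dimensional jet space `J^k(ℝⁿ, ℝᵐ)`. -/
abbrev FinJet (n m k : ℕ) : Type := lowCoords n m k → ℝ

/-- The projection `J^∞ → J^k`. -/
def jetProj {n m : ℕ} (k : ℕ) (z : Jet n m) : FinJet n m k := fun c => z c

/-- The coordinates of order greater than `k`. -/
abbrev HighCoord (n m k : ℕ) : Type := {c : Coord n m // c ∉ lowCoords n m k}

/-- The point of `J^∞` with coordinates `p` up to order `k` and `w` above order `k`. -/
def glue {n m : ℕ} (k : ℕ) (p : FinJet n m k) (w : HighCoord n m k → ℝ) : Jet n m :=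
  fun c => if h : c ∈ lowCoords n m k then p ⟨c, h⟩ else w ⟨c, h⟩

/-- `F` is, on `W`, a `C^∞` function of finitely many coordinates: it factors through the
projection to a finite subproduct `ℝ^S`, followed by a `C^∞` function on an open set of it. -/
def IsSmoothOn {n m : ℕ} (W : Set (Jet n m)) (F : Jet n m → ℝ) : Prop :=
  ∃ (S : Finset (Coord n m)) (U : Set (S → ℝ)) (Ψ : (S → ℝ) → ℝ),
    IsOpen U ∧ ContDiffOn ℝ ∞ Ψ U ∧ ∀ z ∈ W, S.restrict z ∈ U ∧ F z = Ψ (S.restrict z)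

/-- The partial derivative `∂F/∂c` with respect to the coordinate `c`. -/
def partialD {n m : ℕ} (c : Coord n m) (F : Jet n m → ℝ) (z : Jet n m) : ℝ :=
  deriv (fun s : ℝ => F (Function.update z c s)) (z c)

/-- The total derivative `D^i F = ∂F/∂x_i + ∑_{(L, α)} y_L^{α+i} ∂F/∂y_L^α`. For a smooth function
of finitely many coordinates the sum has only finitely many nonzero terms. -/
def totalD {n m : ℕ} (i : Fin n) (F : Jet n m → ℝ) (z : Jet n m) : ℝ :=
  partialD (Sum.inl i) F z +
    ∑ᶠ q : Multipair n m, z (Sum.inr (q.1, q.2 + Pi.single i 1)) * partialD (Sum.inr q) F z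

/-- A vector field on (a subset of) `J^∞`, given by its components: `X (Sum.inl i)` is the
coefficient `ξ_i` of `∂/∂x_i`, and `X (Sum.inr (L, α))` the coefficient `η_L^α` of `∂/∂y_L^α`. -/
abbrev JetField (n m : ℕ) : Type := Coord n m → Jet n m → ℝ

/-- `X` is a Lie-Bäcklund field on `W`: every component is a smooth function of finitely many
coordinates, and `η_L^{α+i} = D^i η_L^α - ∑_j y_L^{α+j} D^i ξ_j`. -/
structure IsLieBacklund {n m : ℕ} (W : Set (Jet n m)) (X : JetField n m) : Prop where
  smooth : ∀ c, IsSmoothOn W (X c)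
  prolong : ∀ z ∈ W, ∀ (L : Fin m) (α : Fin n → ℕ) (i : Fin n),
    X (Sum.inr (L, α + Pi.single i 1)) z =
      totalD i (X (Sum.inr (L, α))) z -
        ∑ j, z (Sum.inr (L, α + Pi.single j 1)) * totalD i (X (Sum.inl j)) z

/-- The set `B` of the multipairs `(M, β)` such that one of the principal components `ξ_i`, `η_L^0`
has a partial derivative with respect to `y_M^β` that does not vanish identically on `W`. -/
def principalSupport {n m : ℕ} (W : Set (Jet n m)) (X : JetField n m) : Set (Multipair n m) :=
  {q | (∃ i : Fin n, ∃ z ∈ W, partialD (Sum.inr q) (X (Sum.inl i)) z ≠ 0) ∨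
       (∃ L : Fin m, ∃ z ∈ W, partialD (Sum.inr q) (X (Sum.inr (L, 0))) z ≠ 0)}

open Classical in
/-- The component `X c` at a fixed point `p` of `J^k`, as a polynomial in the coordinates of order
greater than `k`. -/
def highPoly {n m : ℕ} (X : JetField n m) (k : ℕ) (c : Coord n m) (p : FinJet n m k) :
    MvPolynomial (HighCoord n m k) ℝ :=
  if h : ∃ P : MvPolynomial (HighCoord n m k) ℝ, ∀ w, MvPolynomial.eval w P = X c (glue k p w)
  then h.choose else 0

/-- There is at most one such polynomial. -/
theorem highPoly_eq {n m : ℕ} {X : JetField n m} {k : ℕ} {c : Coord n m} {p : FinJet n m k}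
    {P : MvPolynomial (HighCoord n m k) ℝ}
    (hP : ∀ w, MvPolynomial.eval w P = X c (glue k p w)) : highPoly X k c p = P := by
  have h : ∃ P : MvPolynomial (HighCoord n m k) ℝ,
      ∀ w, MvPolynomial.eval w P = X c (glue k p w) := ⟨P, hP⟩
  have h2 : highPoly X k c p = h.choose := dif_pos h
  rw [h2]
  exact MvPolynomial.funext fun w => by rw [h.choose_spec w, hP w]

/-- The truncated field `X^(k)` on `J^k`: of each component one keeps the term of degree zero in the
coordinates of order greater than `k`, that is, its value where these coordinates are zero. -/
def truncField {n m : ℕ} (X : JetField n m) (k : ℕ) (p : FinJet n m k) : FinJet n m k :=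
  fun c => X c (glue k p 0)

/-- The field `Y_ℓ^(k)` on `J^k` that belongs to the monomial with exponent `ℓ` in the coordinates
of order greater than `k`: its component along `∂/∂y_L^α` is the coefficient of that monomial in
`η_L^α`, and it has no components along the `∂/∂x_i`. -/
def coeffField {n m : ℕ} (X : JetField n m) (k : ℕ) (ℓ : HighCoord n m k →₀ ℕ)
    (p : FinJet n m k) : FinJet n m k :=
  fun c => match c.1 with
    | Sum.inl _ => 0
    | Sum.inr q => (highPoly X k (Sum.inr q) p).coeff ℓ

/-- `γ` is an integral curve of `v` inside `V` that starts at `p` at time `0` and is defined on an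
open interval that contains `0` and `t`. -/
def IsCurveTo {E : Type*} [NormedAddCommGroup E] [NormedSpace ℝ E] (V : Set E) (v : E → E)
    (p : E) (t : ℝ) (γ : ℝ → E) : Prop :=
  ∃ a b : ℝ, (0 : ℝ) ∈ Set.Ioo a b ∧ t ∈ Set.Ioo a b ∧ γ 0 = p ∧
    (∀ s ∈ Set.Ioo a b, γ s ∈ V) ∧ IsIntegralCurveOn γ (fun _ => v) (Set.Ioo a b)

/-- The domain of the maximal flow of `v` in `V`. -/
def flowDomain {E : Type*} [NormedAddCommGroup E] [NormedSpace ℝ E] (V : Set E) (v : E → E) :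
    Set (E × ℝ) :=
  {q | ∃ γ, IsCurveTo V v q.1 q.2 γ}

open Classical in
/-- The maximal flow `Φ_t(p)` of `v` in `V` (with the value `p` outside its domain). -/
def maxFlow {E : Type*} [NormedAddCommGroup E] [NormedSpace ℝ E] (V : Set E) (v : E → E)
    (t : ℝ) (p : E) : E :=
  if h : ∃ γ, IsCurveTo V v p t γ then h.choose t else p

/-- The data of a local map `(z, t) ↦ Φ_t(z)` from `J^∞ × ℝ` to `J^∞`, each component of which
depends on finitely many coordinates, the same for all `t`: the component `c` depends on `t` and on
the coordinates in `dep c`, is defined on `dom c` and given there by `val c`. -/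
structure FlowData (n m : ℕ) where
  dep : Coord n m → Finset (Coord n m)
  dom : ∀ c, Set ((dep c → ℝ) × ℝ)
  val : ∀ c, (dep c → ℝ) × ℝ → ℝ

namespace FlowData

variable {n m : ℕ} (Φ : FlowData n m)

/-- The component `c` of `Φ_t(z)` is defined. -/
def Defined (c : Coord n m) (t : ℝ) (z : Jet n m) : Prop :=
  ((Φ.dep c).restrict z, t) ∈ Φ.dom c

/-- `Φ_t(z)`; its component `c` is meaningful where it is defined. -/
def map (t : ℝ) (z : Jet n m) : Jet n m :=
  fun c => Φ.val c ((Φ.dep c).restrict z, t)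

end FlowData

/-- `Φ` is a (local) flow of the field `X` on `W`, each component of which is a smooth function of
`t` and of finitely many coordinates, defined for each `z ∈ W` at least for small `|t|`. In the
group law the component `c` of `Φ_t(Φ_s(z))` is defined if the components of `Φ_s(z)` on which it
depends are, and if `t` is admissible at these values. -/
structure IsFlow {n m : ℕ} (W : Set (Jet n m)) (X : JetField n m) (Φ : FlowData n m) : Prop where
  isOpen_dom : ∀ c, IsOpen (Φ.dom c)
  smooth : ∀ c, ContDiffOn ℝ ∞ (Φ.val c) (Φ.dom c)
  defined_zero : ∀ z ∈ W, ∀ c, Φ.Defined c 0 z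
  map_zero : ∀ z ∈ W, Φ.map 0 z = z
  hasDerivAt : ∀ z ∈ W, ∀ c, HasDerivAt (fun t => Φ.map t z c) (X c z) 0
  map_map : ∀ z ∈ W, ∀ (c : Coord n m) (s t : ℝ),
    (∀ d ∈ Φ.dep c, Φ.Defined d s z) → Φ.Defined c t (Φ.map s z) → Φ.Defined c (t + s) z →
      Φ.map t (Φ.map s z) c = Φ.map (t + s) z c

/-- The field `X` on `W` is exponentiable. -/
def Exponentiable {n m : ℕ} (W : Set (Jet n m)) (X : JetField n m) : Prop :=
  ∃ Φ : FlowData n m, IsFlow W X Φ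

/-- Condition (⋆) in order `k` for the components of order at most `r`: on the whole domain of the
maximal flow `Φ_t` of `X^(k)` in `V ⊆ J^k`, each field `Y_ℓ^(k)`, with `ℓ` the exponent of a
nonconstant monomial, annihilates the components of `Φ_t` along the coordinates `x_i` and `y_L^α`,
`|α| ≤ r`. -/
def StarCondition {n m : ℕ} (k r : ℕ) (V : Set (FinJet n m k)) (X : JetField n m) : Prop :=
  ∀ (ℓ : HighCoord n m k →₀ ℕ), ℓ ≠ 0 →
    ∀ c : lowCoords n m k, coordOrder c.1 ≤ r →
      ∀ (p : FinJet n m k) (t : ℝ), (p, t) ∈ flowDomain V (truncField X k) →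
        fderiv ℝ (fun q => maxFlow V (truncField X k) t q c) p (coeffField X k ℓ p) = 0

end LieBacklund

end

/-! A field on `J^∞` has no existence theory for its integral curves, so the flow is obtained from a
linear problem instead: for each coordinate `c`, find a function `G_c` of time and finitely many
coordinates with `(∂/∂t - X) G_c = 0` that equals the coordinate `c` at `t = 0`.

For the coordinates `x_i` and `y_L^0` such functions come from `J^k`. There `X` is `X^(k) + ∑ μ_ℓ
Y_ℓ`, with `μ_ℓ` the nonconstant monomials in the coordinates of order greater than `k`. A component
of the flow of `X^(k)` satisfies `∂G/∂t = X^(k) G`, and (⋆) says that the `Y_ℓ` annihilate it, so it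
satisfies `∂G/∂t = X G` as well (`isTransported_maxFlow`). The polynomial form of `X` on the fibres
follows from the prolongation formula, since the principal components depend only on `J^k` when `|A|
≤ k`.

The other coordinates are reached by prolongation (`IsTransported.prolongStep`). The Lie-Bäcklund
condition amounts to `[∂/∂t - X, D^i] = ∑_j D^i ξ_j · D^j`. If the `G_l` and `F` solve the transport
equation, this relation shows that the solution `H` of the linear system `∑_l D^i G_l · H_l = D^i F`
solves it too; at `t = 0` the matrix is the identity, so the system is solvable for small times.
Induction on `|α|` finishes.

It remains to see that the `G_c` form a flow. Solutions of the transport equation with initial value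
zero vanish near `t = 0` (`eventually_eq_zero_of_transport`, by characteristics in a finite
subproduct). Applied to `∂G_c/∂t - X_c(G)`, this gives the equation of integral curves
(`eventually_curve_equation`). Then `r ↦ G_c(G(z, r), t + s - r)` has derivative zero, which is the
group law (`family_add`).

The group law is demanded wherever the components involved are defined, so the domains must be
chosen such that definedness forces the curve `G(z, r)` to behave well for all `|r| ≤ |s|`. This
condition for the component `c` involves more coordinates than `G_c` does; it is therefore built
into the domain of another component `g c` on which `c` is declared to depend
(`exists_dependence_sets`, `transportFlow`). -/

noncomputable section

namespace LieBacklund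

open Set Filter Topology

universe u

/-! ### Smoothness of composition operators on spaces of continuous maps. -/

section Nemytskii

variable {K : Type*} [TopologicalSpace K] [CompactSpace K]

/-- Pointwise evaluation of a continuous family of linear maps on a continuous family of vectors,
as a continuous bilinear map. -/
def pointwiseApply (K : Type*) [TopologicalSpace K] [CompactSpace K] (E F : Type*)
    [NormedAddCommGroup E] [NormedSpace ℝ E] [NormedAddCommGroup F] [NormedSpace ℝ F] :
    C(K, E →L[ℝ] F) →L[ℝ] C(K, E) →L[ℝ] C(K, F) :=
  LinearMap.mkContinuous₂
    (LinearMap.mk₂ ℝ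
      (fun (A : C(K, E →L[ℝ] F)) (h : C(K, E)) =>
        (⟨fun s => A s (h s), A.continuous.clm_apply h.continuous⟩ : C(K, F)))
      (fun _ _ _ => by ext; simp) (fun _ _ _ => by ext; simp)
      (fun _ _ _ => by ext; simp) (fun _ _ _ => by ext; simp))
    1 (fun A h => by
      rw [one_mul, ContinuousMap.norm_le _ (by positivity)]
      intro s
      exact (A s).le_of_opNorm_le_of_le (A.norm_coe_le_norm s) (h.norm_coe_le_norm s))

@[simp]
theorem pointwiseApply_apply {E F : Type*}
    [NormedAddCommGroup E] [NormedSpace ℝ E] [NormedAddCommGroup F] [NormedSpace ℝ F]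
    (A : C(K, E →L[ℝ] F)) (h : C(K, E)) (s : K) : pointwiseApply K E F A h s = A s (h s) := rfl

/-- A `C^∞` map with compact support acts smoothly on continuous maps by composition: the
derivative. -/
theorem hasFDerivAt_comp_left {E F : Type*}
    [NormedAddCommGroup E] [NormedSpace ℝ E] [NormedAddCommGroup F] [NormedSpace ℝ F]
    {v : E → F} (hv : ContDiff ℝ ∞ v) (hc : HasCompactSupport v)
    (hv' : Continuous (fderiv ℝ v)) (γ : C(K, E)) :
    HasFDerivAt (fun γ : C(K, E) => (⟨v, hv.continuous⟩ : C(E, F)).comp γ)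
      (pointwiseApply K E F ((⟨fderiv ℝ v, hv'⟩ : C(E, E →L[ℝ] F)).comp γ)) γ := by
  have h1 : ContDiff ℝ 1 (fderiv ℝ v) := (contDiff_infty_iff_fderiv.1 hv).2.of_le (by norm_cast)
  obtain ⟨C, hC⟩ := h1.lipschitzWith_of_hasCompactSupport (hc.fderiv ℝ) one_ne_zero
  have hd : Differentiable ℝ v := hv.differentiable (by simp)
  refine HasFDerivAt.of_isLittleO (𝕜 := ℝ) ?_
  -- The derivative of `v` is globally Lipschitz because of compact support. The mean value
  -- inequality on the ball about `γ s` then bounds the remainder quadratically, uniformly in `s`.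
  have hbig : (fun x' : C(K, E) => (⟨v, hv.continuous⟩ : C(E, F)).comp x'
      - (⟨v, hv.continuous⟩ : C(E, F)).comp γ
      - pointwiseApply K E F ((⟨fderiv ℝ v, hv'⟩ : C(E, E →L[ℝ] F)).comp γ) (x' - γ))
      =O[𝓝 γ] fun x' => ‖x' - γ‖ ^ 2 := by
    refine Asymptotics.IsBigO.of_bound C (Eventually.of_forall fun x' => ?_)
    rw [ContinuousMap.norm_le _ (by positivity)]
    intro s
    have hs : ‖x' s - γ s‖ ≤ ‖x' - γ‖ := (x' - γ).norm_coe_le_norm s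
    have := (convex_closedBall (γ s) ‖x' s - γ s‖).norm_image_sub_le_of_norm_hasFDerivWithin_le'
      (f := v) (f' := fderiv ℝ v) (φ := fderiv ℝ v (γ s)) (C := C * ‖x' s - γ s‖) (x := γ s)
      (y := x' s)
      (fun x _ => (hd x).hasFDerivAt.hasFDerivWithinAt) (fun x hx => by
        have := hC.dist_le_mul x (γ s)
        rw [dist_eq_norm, dist_eq_norm] at this
        refine this.trans ?_
        gcongr
        simpa [dist_eq_norm] using hx)
      (by simp) (by simp [dist_eq_norm])
    simp only [ContinuousMap.sub_apply, ContinuousMap.comp_apply, ContinuousMap.coe_mk,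
      pointwiseApply_apply, norm_pow, norm_norm]
    refine this.trans ?_
    rw [mul_assoc, ← sq]
    gcongr
  exact hbig.trans_isLittleO (Asymptotics.isLittleO_pow_sub_sub γ one_lt_two)

/-- The derivative is again a composition operator, with `fderiv ℝ v` in place of `v`, followed by a
continuous linear map. The induction therefore has to run over all target spaces at once, and one
universe for both spaces keeps `E →L[ℝ] F` in range. -/
theorem contDiff_comp_left_nat (n : ℕ) : ∀ {E F : Type u}
    [NormedAddCommGroup E] [NormedSpace ℝ E] [NormedAddCommGroup F] [NormedSpace ℝ F]
    {v : E → F} (hv : ContDiff ℝ ∞ v) (_ : HasCompactSupport v),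
    ContDiff ℝ n (fun γ : C(K, E) => (⟨v, hv.continuous⟩ : C(E, F)).comp γ) := by
  induction n with
  | zero =>
    intro E F _ _ _ _ v hv hc
    exact contDiff_zero.2 (ContinuousMap.continuous_postcomp _)
  | succ n ih =>
    intro E F _ _ _ _ v hv hc
    have h1 := (contDiff_infty_iff_fderiv.1 hv).2
    exact contDiff_succ_iff_hasFDerivAt.2
      ⟨fun γ => pointwiseApply K E F ((⟨fderiv ℝ v, h1.continuous⟩ : C(E, E →L[ℝ] F)).comp γ),
      ContDiff.comp (g := pointwiseApply K E F) (ContinuousLinearMap.contDiff _)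
        (ih h1 (hc.fderiv ℝ)), fun γ => hasFDerivAt_comp_left hv hc h1.continuous γ⟩

/-- A `C^∞` map with compact support acts smoothly on continuous maps by composition. -/
theorem contDiff_comp_left {E F : Type u}
    [NormedAddCommGroup E] [NormedSpace ℝ E] [NormedAddCommGroup F] [NormedSpace ℝ F]
    {v : E → F} (hv : ContDiff ℝ ∞ v) (hc : HasCompactSupport v) :
    ContDiff ℝ ∞ (fun γ : C(K, E) => (⟨v, hv.continuous⟩ : C(E, F)).comp γ) :=
  contDiff_infty.2 fun n => contDiff_comp_left_nat n hv hc

end Nemytskii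

/-! ### Picard's integral equation and its smooth dependence on parameters. -/

section Flow

variable {E : Type u} [NormedAddCommGroup E] [NormedSpace ℝ E] [CompleteSpace E]

/-- The primitive vanishing at `0` of a continuous curve on `[-1, 1]`. -/
def primitive (E : Type u) [NormedAddCommGroup E] [NormedSpace ℝ E] [CompleteSpace E] :
    C(Icc (-1 : ℝ) 1, E) →L[ℝ] C(Icc (-1 : ℝ) 1, E) :=
  LinearMap.mkContinuous
    { toFun := fun c => ⟨fun s => ∫ τ in (0 : ℝ)..s, IccExtend (by norm_num) c τ,
        (intervalIntegral.continuous_primitive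
          (fun _ _ => (c.continuous.Icc_extend').intervalIntegrable _ _) 0).comp
            continuous_subtype_val⟩
      map_add' := fun c d => by
        ext s
        simp only [ContinuousMap.coe_mk, ContinuousMap.add_apply]
        rw [← intervalIntegral.integral_add (c.continuous.Icc_extend'.intervalIntegrable _ _)
          (d.continuous.Icc_extend'.intervalIntegrable _ _)]
        rfl
      map_smul' := fun a c => by
        ext s
        simp only [ContinuousMap.coe_mk, ContinuousMap.smul_apply, RingHom.id_apply]
        rw [← intervalIntegral.integral_smul]
        rfl }
    1 (fun c => by
      rw [one_mul, ContinuousMap.norm_le _ (by positivity)]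
      intro s
      have := intervalIntegral.norm_integral_le_of_norm_le_const (a := 0) (b := (s : ℝ))
        (f := IccExtend (by norm_num) c) (C := ‖c‖) (fun τ _ => c.norm_coe_le_norm _)
      refine this.trans ?_
      have h2 : |(s : ℝ) - 0| ≤ 1 := by rw [sub_zero, abs_le]; exact s.2
      exact mul_le_of_le_one_right (norm_nonneg _) h2)

theorem primitive_apply (c : C(Icc (-1 : ℝ) 1, E)) (s : Icc (-1 : ℝ) 1) :
    primitive E c s = ∫ τ in (0 : ℝ)..s, IccExtend (by norm_num) c τ := rfl

theorem norm_primitive_le : ‖primitive E‖ ≤ 1 := LinearMap.mkContinuous_norm_le _ zero_le_one _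

theorem hasDerivAt_primitive (c : C(Icc (-1 : ℝ) 1, E)) {t : ℝ} (ht : t ∈ Ioo (-1 : ℝ) 1) :
    HasDerivAt (fun s => ∫ τ in (0 : ℝ)..s, IccExtend (by norm_num) c τ)
      (c ⟨t, Ioo_subset_Icc_self ht⟩) t := by
  have hc : Continuous (IccExtend (by norm_num : (-1 : ℝ) ≤ 1) c) := c.continuous.Icc_extend'
  have := intervalIntegral.integral_hasDerivAt_right (hc.intervalIntegrable 0 t)
    hc.aestronglyMeasurable.stronglyMeasurableAtFilter hc.continuousAt
  rwa [IccExtend_of_mem (by norm_num) _ (Ioo_subset_Icc_self ht)] at this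

/-- The integral equation satisfied by the time-rescaled integral curves of `v`. -/
def picardMap {v : E → E} (hv : Continuous v) (q : E × ℝ) (c : C(Icc (-1 : ℝ) 1, E)) :
    C(Icc (-1 : ℝ) 1, E) :=
  ContinuousMap.const _ q.1 + q.2 • primitive E ((⟨v, hv⟩ : C(E, E)).comp c)

theorem lipschitzWith_picardMap {v : E → E} (hv : Continuous v) {L : NNReal}
    (hL : LipschitzWith L v) (q : E × ℝ) : LipschitzWith (‖q.2‖₊ * L) (picardMap hv q) := by
  refine LipschitzWith.of_dist_le_mul fun c d => ?_
  have h1 : picardMap hv q c - picardMap hv q d =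
      q.2 • primitive E ((⟨v, hv⟩ : C(E, E)).comp c - (⟨v, hv⟩ : C(E, E)).comp d) := by
    rw [map_sub, smul_sub]; unfold picardMap; abel
  rw [dist_eq_norm, h1, norm_smul, NNReal.coe_mul, mul_assoc, coe_nnnorm]
  gcongr
  refine ((primitive E).le_of_opNorm_le norm_primitive_le _).trans ?_
  rw [one_mul, ContinuousMap.norm_le _ (by positivity)]
  intro s
  have h2 := hL.dist_le_mul (c s) (d s)
  rw [dist_eq_norm] at h2
  refine h2.trans ?_
  gcongr
  exact ContinuousMap.dist_apply_le_dist s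

theorem contDiff_sub_picardMap {v : E → E} (hv : ContDiff ℝ ∞ v) (hc : HasCompactSupport v) :
    ContDiff ℝ ∞ (fun u : (E × ℝ) × C(Icc (-1 : ℝ) 1, E) =>
      u.2 - picardMap hv.continuous u.1 u.2) := by
  have hconst : ContDiff ℝ ∞ (fun p : E => ContinuousMap.const (Icc (-1 : ℝ) 1) p) :=
    (ContinuousLinearMap.mk (M := E) (M₂ := C(Icc (-1 : ℝ) 1, E)) (σ := RingHom.id ℝ)
      { toFun := fun p => ContinuousMap.const (Icc (-1 : ℝ) 1) p
        map_add' := fun _ _ => rfl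
        map_smul' := fun _ _ => rfl } ContinuousMap.continuous_const').contDiff
  refine contDiff_snd.sub (ContDiff.add (hconst.comp (contDiff_fst.comp contDiff_fst)) ?_)
  exact (contDiff_snd.comp contDiff_fst).smul
    ((primitive E).contDiff.comp ((contDiff_comp_left hv hc).comp contDiff_snd))

/-- The partial derivative in the curve is the identity minus an operator of norm at most `|h| L <
1`, so the Neumann series inverts it. -/
theorem isInvertible_fderiv_sub_picardMap {v : E → E} (hv : ContDiff ℝ ∞ v)
    (hc : HasCompactSupport v) {L : NNReal} (hL : LipschitzWith L v) {q : E × ℝ}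
    (hq : ‖q.2‖ * L < 1) (c : C(Icc (-1 : ℝ) 1, E)) :
    (fderiv ℝ (fun u : (E × ℝ) × C(Icc (-1 : ℝ) 1, E) =>
      u.2 - picardMap hv.continuous u.1 u.2) (q, c) ∘L .inr ℝ _ _).IsInvertible := by
  have hv1 := (contDiff_infty_iff_fderiv.1 hv).2.continuous
  set B := pointwiseApply (Icc (-1 : ℝ) 1) E E ((⟨fderiv ℝ v, hv1⟩ : C(E, E →L[ℝ] E)).comp c)
    with hB
  have hBn : ‖B‖ ≤ L := by
    refine ContinuousLinearMap.opNorm_le_bound _ L.2 fun h => ?_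
    rw [ContinuousMap.norm_le _ (by positivity)]
    intro s
    exact (fderiv ℝ v (c s)).le_of_opNorm_le_of_le (norm_fderiv_le_of_lipschitz ℝ hL)
      (h.norm_coe_le_norm s)
  set T := q.2 • (primitive E ∘L B) with hT
  have hTn : ‖T‖ < 1 := by
    refine lt_of_le_of_lt ((ContinuousLinearMap.opNorm_smul_le _ _).trans ?_) hq
    gcongr
    refine (ContinuousLinearMap.opNorm_comp_le _ _).trans ?_
    calc ‖primitive E‖ * ‖B‖ ≤ 1 * L := by gcongr; exact norm_primitive_le
      _ = L := one_mul _
  have h1 : HasFDerivAt (fun d => d - picardMap hv.continuous q d)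
      (ContinuousLinearMap.id ℝ _ - T) c := by
    refine (hasFDerivAt_id c).sub ?_
    refine HasFDerivAt.const_add _ ?_
    exact ((primitive E).hasFDerivAt.comp c (hasFDerivAt_comp_left hv hc hv1 c)).const_smul q.2
  have h2 : HasFDerivAt (fun d => d - picardMap hv.continuous q d)
      (fderiv ℝ (fun u : (E × ℝ) × C(Icc (-1 : ℝ) 1, E) =>
      u.2 - picardMap hv.continuous u.1 u.2) (q, c) ∘L .inr ℝ _ _) c := by
    have h3 := ((contDiff_sub_picardMap hv hc).differentiable (by simp) (q, c)).hasFDerivAt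
    exact h3.comp c (hasFDerivAt_prodMk_right q c)
  rw [h2.unique h1]
  exact ⟨ContinuousLinearEquiv.ofUnit (Units.oneSub T hTn), rfl⟩

/-- Contraction gives a unique fixed point for every initial point, with one bound `δ` for all of
them. The fixed point is first shown to be continuous in the parameters; it then must agree with the
local solution of the implicit function theorem, and is smooth. -/
theorem exists_smooth_curve {v : E → E} (hv : ContDiff ℝ ∞ v) (hc : HasCompactSupport v) :
    ∃ δ > 0, ∃ c : E × ℝ → C(Icc (-1 : ℝ) 1, E), ContDiffOn ℝ ∞ c (univ ×ˢ Ioo (-δ) δ) ∧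
      ∀ p, ∀ h ∈ Ioo (-δ) δ, ∀ d, d = picardMap hv.continuous (p, h) d ↔ d = c (p, h) := by
  obtain ⟨L, hL⟩ := (hv.of_le (by norm_cast : (1 : WithTop ℕ∞) ≤ ∞)).lipschitzWith_of_hasCompactSupport hc one_ne_zero
  -- Chosen so that `|h| L ≤ 1 / 2`; the summand `1` avoids dividing by zero when `L = 0`.
  set δ : ℝ := 1 / (2 * (L + 1)) with hδ
  have hL0 : (0 : ℝ) ≤ L := L.2
  have hδ0 : 0 < δ := by positivity
  have hlt : ∀ h ∈ Ioo (-δ) δ, ‖h‖₊ * L ≤ 1 / 2 := by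
    intro h hh
    have h1 : |h| < δ := abs_lt.2 hh
    rw [← NNReal.coe_le_coe]
    push_cast
    rw [Real.norm_eq_abs]
    have : |h| * L ≤ δ * (L + 1) := by gcongr; linarith
    have h3 : δ * (L + 1) = 1 / 2 := by rw [hδ]; field_simp
    linarith
  have hcontr : ∀ q : E × ℝ, q.2 ∈ Ioo (-δ) δ →
      ContractingWith (1 / 2) (picardMap hv.continuous q) := fun q hq =>
    ⟨by rw [← NNReal.coe_lt_coe]; norm_num,
      (lipschitzWith_picardMap hv.continuous hL q).weaken (hlt _ hq)⟩
  classical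
  let c : E × ℝ → C(Icc (-1 : ℝ) 1, E) := fun q =>
    if hq : q.2 ∈ Ioo (-δ) δ then (hcontr q hq).fixedPoint else 0
  have hcdef : ∀ q (hq : q.2 ∈ Ioo (-δ) δ), c q = (hcontr q hq).fixedPoint := fun q hq => dif_pos hq
  have hfix : ∀ q : E × ℝ, q.2 ∈ Ioo (-δ) δ → picardMap hv.continuous q (c q) = c q := by
    intro q hq
    rw [hcdef q hq]
    exact (hcontr q hq).fixedPoint_isFixedPt
  have hnear : ∀ q : E × ℝ, q.2 ∈ Ioo (-δ) δ → ∀ᶠ q' in 𝓝 q, q'.2 ∈ Ioo (-δ) δ := fun q hq =>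
    continuous_snd.continuousAt.eventually_mem (Ioo_mem_nhds hq.1 hq.2)
  have hcont : ∀ q : E × ℝ, q.2 ∈ Ioo (-δ) δ → ContinuousAt c q := by
    intro q hq
    rw [ContinuousAt, tendsto_iff_dist_tendsto_zero]
    -- The distance from `c q` to the fixed point for `q'` is controlled by how far the map for `q'`
    -- moves `c q`, and the map for `q` does not move it.
    have hlim : Tendsto (fun q' : E × ℝ => dist (c q) (picardMap hv.continuous q' (c q)) / (1 - (1 / 2 : NNReal)))
        (𝓝 q) (𝓝 0) := by
      have h1 : Continuous (fun q' : E × ℝ => c q - picardMap hv.continuous q' (c q)) :=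
        (contDiff_sub_picardMap hv hc).continuous.comp (continuous_id.prodMk continuous_const)
      have h2 : Continuous (fun q' : E × ℝ => dist (c q) (picardMap hv.continuous q' (c q)) / (1 - (1 / 2 : NNReal))) := by
        simp_rw [dist_eq_norm]
        exact h1.norm.div_const _
      have h3 := h2.tendsto q
      simpa [hfix q hq] using h3
    refine squeeze_zero' (Eventually.of_forall fun _ => dist_nonneg) ?_ hlim
    filter_upwards [hnear q hq] with q' hq'
    rw [dist_comm]
    exact (hcontr q' hq').dist_le_of_fixedPoint _ (hfix q' hq')
  refine ⟨δ, hδ0, c, ?_, ?_⟩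
  · rintro q ⟨-, hq⟩
    refine ContDiffAt.contDiffWithinAt ?_
    have hF := (contDiff_sub_picardMap hv hc).contDiffAt (x := (q, c q))
    have hinv := isInvertible_fderiv_sub_picardMap hv hc hL (q := q) (by
      have := NNReal.coe_le_coe.2 (hlt q.2 hq)
      push_cast at this
      linarith) (c q)
    have hψ := hF.contDiffAt_implicitFunction (by simp) hinv
    have hiff := hF.eventually_apply_eq_iff_implicitFunction (by simp) hinv
    have htend : Tendsto (fun q' => (q', c q')) (𝓝 q) (𝓝 (q, c q)) :=
      (continuousAt_id.prodMk (hcont q hq)).tendsto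
    refine hψ.congr_of_eventuallyEq ?_
    filter_upwards [htend.eventually hiff, hnear q hq] with q' h1 h2
    exact (h1.1 (by rw [hfix q hq, hfix q' h2, sub_self, sub_self])).symm
  · intro p h hh d
    constructor
    · intro hd
      rw [hcdef _ hh]
      exact (hcontr _ hh).fixedPoint_unique hd.symm
    · rintro rfl
      exact (hfix _ hh).symm

end Flow

/-! ### Smooth local flows, uniqueness of integral curves, and the maximal flow. -/

section Flow

variable {E : Type u} [NormedAddCommGroup E] [NormedSpace ℝ E]

/-- The curve `c (p, h)` is the integral curve from `p` run at speed `h` over `[-1, 1]`. Evaluation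
at the fixed time `1`, with `h` as the time variable, makes the flow jointly smooth in point and
time. -/
theorem exists_global_smooth_flow [CompleteSpace E] {v : E → E} (hv : ContDiff ℝ ∞ v)
    (hc : HasCompactSupport v) :
    ∃ δ > 0, ∃ Θ : E × ℝ → E, ContDiffOn ℝ ∞ Θ (univ ×ˢ Ioo (-δ) δ) ∧ ∀ p, Θ (p, 0) = p ∧
      ∀ t ∈ Ioo (-δ) δ, HasDerivAt (fun s => Θ (p, s)) (v (Θ (p, t))) t := by
  obtain ⟨δ, hδ, c, hcs, hcu⟩ := exists_smooth_curve hv hc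
  have h1mem : (1 : ℝ) ∈ Icc (-1 : ℝ) 1 := by constructor <;> norm_num
  have hle : (-1 : ℝ) ≤ 1 := by norm_num
  -- Slowing the curve of speed `h` by the factor `a` solves the integral equation for speed `h *
  -- a`, so uniqueness applies.
  have hscale : ∀ p, ∀ h ∈ Ioo (-δ) δ, ∀ (a : ℝ) (ha : a ∈ Icc (-1 : ℝ) 1),
      c (p, h * a) ⟨1, h1mem⟩ = c (p, h) ⟨a, ha⟩ := by
    intro p h hh a ha
    have hmul : ∀ s ∈ Icc (-1 : ℝ) 1, a * s ∈ Icc (-1 : ℝ) 1 := by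
      intro s hs
      rw [mem_Icc, ← abs_le] at *
      rw [abs_mul]
      exact mul_le_one₀ ha (abs_nonneg _) hs
    let d : C(Icc (-1 : ℝ) 1, E) :=
      (c (p, h)).comp ⟨fun s => ⟨a * s, hmul s s.2⟩, by fun_prop⟩
    have hha : h * a ∈ Ioo (-δ) δ := by
      rw [mem_Ioo, ← abs_lt] at *
      rw [mem_Icc, ← abs_le] at ha
      rw [abs_mul]
      exact lt_of_le_of_lt (mul_le_of_le_one_right (abs_nonneg _) ha) hh
    have hd : d = picardMap hv.continuous (p, h * a) d := by
      have hfix := (hcu p h hh _).2 rfl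
      ext s
      have h1 := DFunLike.congr_fun hfix ⟨a * s, hmul s s.2⟩
      simp only [picardMap, ContinuousMap.add_apply, ContinuousMap.smul_apply,
        ContinuousMap.const_apply, primitive_apply] at h1 ⊢
      refine h1.trans ?_
      congr 1
      have h2 := intervalIntegral.smul_integral_comp_mul_left (a := 0) (b := (s : ℝ))
        (f := IccExtend hle ((⟨v, hv.continuous⟩ : C(E, E)).comp (c (p, h)))) a
      rw [mul_zero] at h2
      rw [mul_smul, ← h2]
      congr 2
      refine intervalIntegral.integral_congr fun σ hσ => ?_
      have hσ' : σ ∈ Icc (-1 : ℝ) 1 :=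
        (ordConnected_Icc.uIcc_subset (by simp) s.2) hσ
      rw [IccExtend_of_mem hle _ hσ', IccExtend_of_mem hle _ (hmul σ hσ')]
      rfl
    have := (hcu p (h * a) hha d).1 hd
    rw [← this]
    change c (p, h) _ = _
    congr 1
    ext
    simp
  refine ⟨δ / 2, by positivity, fun q => c q ⟨1, h1mem⟩, ?_, ?_⟩
  · have := (ContinuousMap.evalCLM ℝ (M := E) (⟨1, h1mem⟩ : Icc (-1 : ℝ) 1)).contDiff.comp_contDiffOn
      (n := ∞) hcs
    exact this.mono (prod_mono le_rfl (Ioo_subset_Ioo (by linarith) (by linarith)))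
  · intro p
    -- One reference speed `δ / 2` describes all times below `δ / 2` as points of a single curve,
    -- which can be differentiated as a primitive.
    have hh : δ / 2 ∈ Ioo (-δ) δ := by constructor <;> linarith
    have hfix := (hcu p _ hh _).2 rfl
    have key : ∀ t ∈ Ioo (-(δ / 2)) (δ / 2), ∃ ht : t / (δ / 2) ∈ Ioo (-1 : ℝ) 1,
        c (p, t) ⟨1, h1mem⟩ = c (p, δ / 2) ⟨t / (δ / 2), Ioo_subset_Icc_self ht⟩ := by
      intro t ht
      have ht' : t / (δ / 2) ∈ Ioo (-1 : ℝ) 1 := by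
        rw [mem_Ioo, lt_div_iff₀ (by positivity), div_lt_iff₀ (by positivity)]
        constructor <;> linarith [ht.1, ht.2]
      refine ⟨ht', ?_⟩
      rw [← hscale p _ hh _ (Ioo_subset_Icc_self ht')]
      congr 3
      field_simp
    have hform : ∀ s : Icc (-1 : ℝ) 1, c (p, δ / 2) s = p + (δ / 2) •
        ∫ τ in (0 : ℝ)..s, IccExtend hle
          ((⟨v, hv.continuous⟩ : C(E, E)).comp (c (p, δ / 2))) τ :=
      fun s => DFunLike.congr_fun hfix s
    constructor
    · obtain ⟨ht, h0⟩ := key 0 ⟨by linarith, by linarith⟩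
      simp only [h0, hform, zero_div, intervalIntegral.integral_same, smul_zero, add_zero]
    · intro t ht
      obtain ⟨ht', h0⟩ := key t ht
      have hd := hasDerivAt_primitive ((⟨v, hv.continuous⟩ : C(E, E)).comp (c (p, δ / 2))) ht'
      have hd2 := ((hd.scomp t ((hasDerivAt_id t).div_const (δ / 2))).const_smul (δ / 2)).const_add p
      refine (hd2.congr_of_eventuallyEq ?_).congr_deriv ?_
      · filter_upwards [Ioo_mem_nhds ht.1 ht.2] with s hs
        obtain ⟨_, h1⟩ := key s hs
        rw [h1, hform]
        rfl
      · rw [smul_smul, mul_one_div_cancel (by positivity), one_smul]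
        exact (congrArg v h0).symm

/-- A smooth vector field on an open set of a finite dimensional space has a smooth local flow. -/
theorem exists_local_smooth_flow [FiniteDimensional ℝ E] {V : Set E} (hV : IsOpen V) {v : E → E}
    (hv : ContDiffOn ℝ ∞ v V) {p₀ : E} (hp₀ : p₀ ∈ V) :
    ∃ r > 0, ∃ Θ : E × ℝ → E, ContDiffOn ℝ ∞ Θ (Metric.ball p₀ r ×ˢ Ioo (-r) r) ∧
      ∀ p ∈ Metric.ball p₀ r, Θ (p, 0) = p ∧ ∀ t ∈ Ioo (-r) r, Θ (p, t) ∈ V ∧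
        HasDerivAt (fun s => Θ (p, s)) (v (Θ (p, t))) t := by
  have : CompleteSpace E := FiniteDimensional.complete ℝ E
  obtain ⟨R, hR, hRV⟩ := Metric.isOpen_iff.1 hV p₀ hp₀
  -- The cut-off field is `v` itself on the ball of radius `R / 4`, where the trajectories from near
  -- `p₀` stay for short times.
  let χ : ContDiffBump p₀ := ⟨R / 4, R / 2, by positivity, by linarith⟩
  have hsub : tsupport χ ⊆ V := by
    rw [χ.tsupport_eq]
    exact (Metric.closedBall_subset_ball (by change R / 2 < R; linarith)).trans hRV
  have hw : ContDiff ℝ ∞ (fun x => χ x • v x) := by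
    rw [contDiff_iff_contDiffAt]
    intro x
    by_cases hx : x ∈ V
    · exact χ.contDiff.contDiffAt.smul ((hv x hx).contDiffAt (hV.mem_nhds hx))
    · have : (fun x => χ x • v x) =ᶠ[𝓝 x] fun _ => 0 := by
        filter_upwards [(isClosed_tsupport χ).isOpen_compl.mem_nhds (fun h => hx (hsub h))] with y hy
        rw [image_eq_zero_of_notMem_tsupport hy, zero_smul]
      exact contDiffAt_const.congr_of_eventuallyEq this
  obtain ⟨δ, hδ, Θ, hΘ, hode⟩ := exists_global_smooth_flow hw (χ.hasCompactSupport.smul_right)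
  have hcont : ContinuousAt Θ (p₀, 0) :=
    (hΘ.contDiffAt ((isOpen_univ.prod isOpen_Ioo).mem_nhds ⟨mem_univ _, by simpa using hδ⟩)).continuousAt
  have hev : ∀ᶠ q in 𝓝 (p₀, (0 : ℝ)), Θ q ∈ Metric.ball p₀ (R / 4) := by
    refine hcont.eventually_mem ?_
    rw [(hode p₀).1]
    exact Metric.ball_mem_nhds _ (by positivity)
  obtain ⟨ε, hε, hball⟩ := Metric.eventually_nhds_iff_ball.1 hev
  refine ⟨min ε δ, lt_min hε hδ, Θ, hΘ.mono (prod_mono (subset_univ _)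
    (Ioo_subset_Ioo (neg_le_neg (min_le_right _ _)) (min_le_right _ _))), fun p hp => ⟨(hode p).1, ?_⟩⟩
  intro t ht
  have h1 : Θ (p, t) ∈ Metric.ball p₀ (R / 4) := by
    refine hball _ ?_
    rw [← ball_prod_same]
    refine ⟨Metric.ball_subset_ball (min_le_left _ _) hp, ?_⟩
    rw [Real.ball_eq_Ioo, zero_sub, zero_add]
    exact ⟨(neg_le_neg (min_le_left _ _)).trans_lt ht.1, ht.2.trans_le (min_le_left _ _)⟩
  refine ⟨hRV (Metric.ball_subset_ball (by linarith) h1), ?_⟩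
  have h2 := (hode p).2 t ⟨(neg_le_neg (min_le_right _ _)).trans_lt ht.1, ht.2.trans_le (min_le_right _ _)⟩
  rwa [χ.one_of_mem_closedBall (Metric.ball_subset_closedBall h1), one_smul] at h2

/-- Integral curves of a `C^1` field are determined by one of their values. -/
theorem eqOn_of_integralCurves {V : Set E} (hV : IsOpen V) {v : E → E}
    (hv : ContDiffOn ℝ 1 v V) {a b t₀ : ℝ} (ht₀ : t₀ ∈ Ioo a b) {f g : ℝ → E}
    (hf : ∀ t ∈ Ioo a b, f t ∈ V ∧ HasDerivAt f (v (f t)) t)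
    (hg : ∀ t ∈ Ioo a b, g t ∈ V ∧ HasDerivAt g (v (g t)) t) (h0 : f t₀ = g t₀) :
    EqOn f g (Ioo a b) := by
  have key : ∀ t ∈ Ioo a b, f t = g t → f =ᶠ[𝓝 t] g := by
    intro t ht h
    obtain ⟨K, s, hs, hK⟩ :=
      ((hv _ (hf t ht).1).contDiffAt (hV.mem_nhds (hf t ht).1)).exists_lipschitzOnWith
    have hs' := hs
    rw [h] at hs'
    refine ODE_solution_unique_of_eventually (v := fun _ => v) (s := fun _ => s) (K := K)
      (Eventually.of_forall fun _ => hK) ?_ ?_ h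
    · filter_upwards [Ioo_mem_nhds ht.1 ht.2, (hf t ht).2.continuousAt.eventually_mem hs]
        with x h1 h2
      exact ⟨(hf x h1).2, h2⟩
    · filter_upwards [Ioo_mem_nhds ht.1 ht.2, (hg t ht).2.continuousAt.eventually_mem hs']
        with x h1 h2
      exact ⟨(hg x h1).2, h2⟩
  have hsub : Ioo a b ⊆ {t | f =ᶠ[𝓝 t] g} := by
    -- The set where the two curves agree locally is open by definition, and relatively closed
    -- because agreement at one point implies agreement near it.
    refine isPreconnected_Ioo.subset_of_closure_inter_subset isOpen_setOfPred_eventually_nhds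
      ⟨t₀, ht₀, key t₀ ht₀ h0⟩ ?_
    rintro t ⟨htc, ht⟩
    refine key t ht ?_
    by_contra hne
    have hfreq := mem_closure_iff_frequently.1 htc
    have hev : ∀ᶠ s in 𝓝 t, f s ≠ g s :=
      (hf t ht).2.continuousAt.ne_iff_eventually_ne (hg t ht).2.continuousAt |>.1 hne
    obtain ⟨s, h1, h2⟩ := (hfreq.and_eventually hev).exists
    exact h2 h1.self_of_nhds
  exact fun t ht => (hsub ht).self_of_nhds

theorem IsCurveTo.eq {V : Set E} (hV : IsOpen V) {v : E → E} (hv : ContDiffOn ℝ 1 v V) {p : E}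
    {t : ℝ} {γ₁ γ₂ : ℝ → E} (h₁ : IsCurveTo V v p t γ₁) (h₂ : IsCurveTo V v p t γ₂) :
    γ₁ t = γ₂ t := by
  obtain ⟨a, b, h0, ht, hp, hγ, hi⟩ := h₁
  obtain ⟨a', b', h0', ht', hp', hγ', hi'⟩ := h₂
  have hmem : ∀ x, x ∈ Ioo (max a a') (min b b') ↔ x ∈ Ioo a b ∧ x ∈ Ioo a' b' := by
    intro x
    simp only [mem_Ioo, max_lt_iff, lt_min_iff]
    tauto
  exact eqOn_of_integralCurves hV hv ((hmem 0).2 ⟨h0, h0'⟩)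
    (fun s hs => ⟨hγ s ((hmem s).1 hs).1, (hi s ((hmem s).1 hs).1).hasDerivAt
      (isOpen_Ioo.mem_nhds ((hmem s).1 hs).1)⟩)
    (fun s hs => ⟨hγ' s ((hmem s).1 hs).2, (hi' s ((hmem s).1 hs).2).hasDerivAt
      (isOpen_Ioo.mem_nhds ((hmem s).1 hs).2)⟩) (hp.trans hp'.symm) ((hmem t).2 ⟨ht, ht'⟩)

theorem maxFlow_eq {V : Set E} (hV : IsOpen V) {v : E → E} (hv : ContDiffOn ℝ 1 v V) {p : E}
    {t : ℝ} {γ : ℝ → E} (h : IsCurveTo V v p t γ) : maxFlow V v t p = γ t := by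
  have h' : ∃ γ, IsCurveTo V v p t γ := ⟨γ, h⟩
  rw [maxFlow, dif_pos h']
  exact IsCurveTo.eq hV hv h'.choose_spec h

/-- Near time zero the maximal flow is smooth, and satisfies the transport equation
`∂Φ/∂t = DΦ · v`. -/
theorem exists_maxFlow_eq [FiniteDimensional ℝ E] {V : Set E} (hV : IsOpen V) {v : E → E}
    (hv : ContDiffOn ℝ ∞ v V) {p₀ : E} (hp₀ : p₀ ∈ V) :
    ∃ Θ : E × ℝ → E, ∀ᶠ q in 𝓝 (p₀, (0 : ℝ)), ContDiffAt ℝ ∞ Θ q ∧ q ∈ flowDomain V v ∧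
      Θ q ∈ V ∧ Θ (q.1, 0) = q.1 ∧ maxFlow V v q.2 q.1 = Θ q ∧
      HasDerivAt (fun s => Θ (q.1, s)) (v (Θ q)) q.2 ∧
      fderiv ℝ Θ q (0, 1) = fderiv ℝ Θ q (v q.1, 0) := by
  obtain ⟨r, hr, Θ, hΘ, hode⟩ := exists_local_smooth_flow hV hv hp₀
  have hv1 : ContDiffOn ℝ 1 v V := hv.of_le (by norm_cast)
  have hopen : IsOpen (Metric.ball p₀ r ×ˢ Ioo (-r) r) := Metric.isOpen_ball.prod isOpen_Ioo
  have h0r : (0 : ℝ) ∈ Ioo (-r) r := by constructor <;> linarith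
  have hcurve : ∀ p ∈ Metric.ball p₀ r, ∀ t ∈ Ioo (-r) r,
      IsCurveTo V v p t (fun s => Θ (p, s)) := fun p hp t ht =>
    ⟨-r, r, h0r, ht, (hode p hp).1, fun s hs => ((hode p hp).2 s hs).1,
      fun s hs => ((hode p hp).2 s hs).2.hasDerivWithinAt⟩
  refine ⟨Θ, ?_⟩
  filter_upwards [hopen.mem_nhds ⟨Metric.mem_ball_self hr, h0r⟩] with ⟨p, t⟩ hq
  obtain ⟨hp, ht⟩ := hq
  have hp : p ∈ Metric.ball p₀ r := hp
  have ht : t ∈ Ioo (-r) r := ht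
  have hsm : ∀ p ∈ Metric.ball p₀ r, ∀ t ∈ Ioo (-r) r, ContDiffAt ℝ ∞ Θ (p, t) :=
    fun p hp t ht => (hΘ _ ⟨hp, ht⟩).contDiffAt (hopen.mem_nhds ⟨hp, ht⟩)
  refine ⟨hsm p hp t ht, ⟨_, hcurve p hp t ht⟩, ((hode p hp).2 t ht).1, (hode p hp).1,
    maxFlow_eq hV hv1 (hcurve p hp t ht), ((hode p hp).2 t ht).2, ?_⟩
  -- Both sides of `Θ (p, t + s) = Θ (Θ (p, s), t)` are differentiated at `s = 0`.
  have hF := ((hsm p hp t ht).differentiableAt (by simp)).hasFDerivAt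
  have h1 : HasDerivAt (fun s => Θ (p, t + s)) (fderiv ℝ Θ (p, t) (0, 1)) 0 := by
    have h2 : HasDerivAt (fun s : ℝ => (p, t + s)) ((0 : E), (1 : ℝ)) 0 :=
      (hasDerivAt_const 0 p).prodMk ((hasDerivAt_id 0).const_add t)
    exact HasFDerivAt.comp_hasDerivAt_of_eq 0 hF h2 (by simp)
  have h3 : HasDerivAt (fun s => Θ (Θ (p, s), t)) (fderiv ℝ Θ (p, t) (v p, 0)) 0 := by
    have h4 : HasDerivAt (fun s : ℝ => (Θ (p, s), t)) (v p, (0 : ℝ)) 0 := by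
      have := ((hode p hp).2 0 h0r).2
      rw [(hode p hp).1] at this
      exact this.prodMk (hasDerivAt_const 0 t)
    exact HasFDerivAt.comp_hasDerivAt_of_eq 0 hF h4 (by simp [(hode p hp).1])
  refine h1.unique (h3.congr_of_eventuallyEq ?_)
  have hcont : ContinuousAt (fun s => Θ (p, s)) 0 := ((hode p hp).2 0 h0r).2.continuousAt
  have hb : ∀ᶠ s in 𝓝 (0 : ℝ), Θ (p, s) ∈ Metric.ball p₀ r :=
    hcont.eventually_mem (by rw [(hode p hp).1]; exact Metric.isOpen_ball.mem_nhds hp)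
  obtain ⟨ε, hε, hεr⟩ : ∃ ε > 0, |t| + ε < r := by
    have := abs_lt.2 ht
    exact ⟨(r - |t|) / 2, by linarith, by linarith⟩
  filter_upwards [hb, Ioo_mem_nhds (neg_lt_zero.2 hε) hε] with s hs hsε
  have habs := abs_le.1 (le_refl |t|)
  -- The half-length lies strictly between `|t|` and `r - ε`: the interval contains `0` and `t`, and
  -- a shift by `|s| < ε` stays within `(-r, r)`.
  have := eqOn_of_integralCurves hV hv1 (a := -|t| - (r - ε - |t|) / 2)
    (b := |t| + (r - ε - |t|) / 2) (t₀ := 0)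
    (f := fun τ => Θ (p, τ + s)) (g := fun τ => Θ (Θ (p, s), τ))
    (by constructor <;> linarith [abs_nonneg t])
    (fun τ hτ => ?_) (fun τ hτ => ?_) ?_ (x := t) ?_
  · exact this
  · have hτs : τ + s ∈ Ioo (-r) r := by
      constructor <;> linarith [hτ.1, hτ.2, hsε.1, hsε.2]
    obtain ⟨h5, h6⟩ := (hode p hp).2 (τ + s) hτs
    exact ⟨h5, h6.comp_add_const τ s⟩
  · refine (hode _ hs).2 τ ?_
    constructor <;> linarith [hτ.1, hτ.2]
  · simp [(hode _ hs).1]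
  · constructor <;> linarith [abs_nonneg t]

end Flow

/-! ### Calculus of functions of time and finitely many coordinates. -/

section Calculus

variable {ι : Type*} {E E' : Type*} [NormedAddCommGroup E] [NormedSpace ℝ E]
  [NormedAddCommGroup E'] [NormedSpace ℝ E']

/-- A product of real lines together with a time. -/
abbrev TimeJet (ι : Type*) : Type _ := (ι → ℝ) × ℝ

/-- The projection to a finite subproduct, time being kept. -/
def cut (S : Finset ι) : TimeJet ι →L[ℝ] (S → ℝ) × ℝ :=
  (ContinuousLinearMap.pi fun c : S => ContinuousLinearMap.proj (R := ℝ) (c : ι)).prodMap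
    (ContinuousLinearMap.id ℝ ℝ)

@[simp] theorem cut_apply_fst (S : Finset ι) (a : TimeJet ι) (c : S) : (cut S a).1 c = a.1 c := rfl

@[simp] theorem cut_apply_snd (S : Finset ι) (a : TimeJet ι) : (cut S a).2 = a.2 := rfl

/-- The projection between finite subproducts, time being kept. -/
def recut {S T : Finset ι} (h : S ⊆ T) : ((T → ℝ) × ℝ) →L[ℝ] (S → ℝ) × ℝ :=
  (ContinuousLinearMap.pi fun c : S =>
    ContinuousLinearMap.proj (R := ℝ) (φ := fun _ : T => ℝ) ⟨c, h c.2⟩).prodMap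
    (ContinuousLinearMap.id ℝ ℝ)

@[simp] theorem recut_cut {S T : Finset ι} (h : S ⊆ T) (a : TimeJet ι) :
    recut h (cut T a) = cut S a := rfl

/-- Basic open sets of a product restrict only finitely many coordinates. This is what lets
neighbourhoods in `J^∞` be handled in finite dimension. -/
theorem exists_cut_subset {a : TimeJet ι} {s : Set (TimeJet ι)} (hs : s ∈ 𝓝 a) :
    ∃ (S : Finset ι) (U : Set ((S → ℝ) × ℝ)), IsOpen U ∧ cut S a ∈ U ∧ cut S ⁻¹' U ⊆ s := by
  obtain ⟨u, hu, v, hv, huv⟩ := mem_nhds_prod_iff.1 hs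
  obtain ⟨u', hu', huo, hau⟩ := mem_nhds_iff.1 hu
  obtain ⟨v', hv', hvo, hav⟩ := mem_nhds_iff.1 hv
  obtain ⟨I, w, hw, hIw⟩ := isOpen_pi_iff.1 huo a.1 hau
  refine ⟨I, ((univ : Set I).pi fun c => w c) ×ˢ v',
    (isOpen_set_pi (ι := I) finite_univ fun (c : I) _ => (hw c c.2).1).prod hvo,
    ⟨fun c _ => (hw c c.2).2, hav⟩, ?_⟩
  rintro b ⟨hb1, hb2⟩
  exact huv ⟨hu' (hIw fun c hc => hb1 ⟨c, hc⟩ (mem_univ _)), hv' hb2⟩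

/-- Near `a` the map `F` is a smooth function of time and of finitely many coordinates. -/
def SmAt (F : TimeJet ι → E) (a : TimeJet ι) : Prop :=
  ∃ (S : Finset ι) (Ψ : (S → ℝ) × ℝ → E) (U : Set ((S → ℝ) × ℝ)), IsOpen U ∧ cut S a ∈ U ∧
    ContDiffOn ℝ ∞ Ψ U ∧ ∀ b, cut S b ∈ U → F b = Ψ (cut S b)

/-- The derivative along a vector. -/
abbrev dd (F : TimeJet ι → E) (a u : TimeJet ι) : E := lineDeriv ℝ F a u

theorem SmAt.of_eventually {F : TimeJet ι → E} {a : TimeJet ι} (S : Finset ι)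
    (Ψ : (S → ℝ) × ℝ → E) (hΨ : ∀ᶠ x in 𝓝 (cut S a), ContDiffAt ℝ ∞ Ψ x)
    (hF : ∀ᶠ b in 𝓝 a, F b = Ψ (cut S b)) : SmAt F a := by
  classical
  obtain ⟨T, U, hU, haU, hsub⟩ := exists_cut_subset hF
  obtain ⟨U', hU'sub, hU', haU'⟩ := mem_nhds_iff.1 hΨ
  have hS : S ⊆ S ∪ T := Finset.subset_union_left
  have hT : T ⊆ S ∪ T := Finset.subset_union_right
  refine ⟨S ∪ T, Ψ ∘ recut hS, recut hS ⁻¹' U' ∩ recut hT ⁻¹' U,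
    (hU'.preimage (recut hS).continuous).inter (hU.preimage (recut hT).continuous),
    ⟨haU', haU⟩, ?_, ?_⟩
  · rintro x ⟨hx, -⟩
    have : ContDiffAt ℝ ∞ Ψ (recut hS x) := hU'sub hx
    exact (this.comp x (recut hS).contDiff.contDiffAt).contDiffWithinAt
  · rintro b ⟨-, hb⟩
    exact hsub hb

theorem SmAt.congr {F G : TimeJet ι → E} {a : TimeJet ι} (hF : SmAt F a) (h : G =ᶠ[𝓝 a] F) :
    SmAt G a := by
  obtain ⟨S, Ψ, U, hU, haU, hΨ, hFΨ⟩ := hF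
  refine SmAt.of_eventually S Ψ ?_ ?_
  · filter_upwards [hU.mem_nhds haU] with x hx using (hΨ x hx).contDiffAt (hU.mem_nhds hx)
  · filter_upwards [h, (cut S).continuous.continuousAt.eventually_mem (hU.mem_nhds haU)] with b h1 h2
    rw [h1, hFΨ b h2]

theorem SmAt.eventually {F : TimeJet ι → E} {a : TimeJet ι} (hF : SmAt F a) :
    ∀ᶠ b in 𝓝 a, SmAt F b := by
  obtain ⟨S, Ψ, U, hU, haU, hΨ, hFΨ⟩ := hF
  filter_upwards [(cut S).continuous.continuousAt.eventually_mem (hU.mem_nhds haU)] with b hb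
  exact ⟨S, Ψ, U, hU, hb, hΨ, hFΨ⟩

/-- A representation of a smooth function by a function on any sufficiently large finite
subproduct. -/
theorem SmAt.enlarge {S T : Finset ι} (h : S ⊆ T) {F : TimeJet ι → E} {a : TimeJet ι}
    {Ψ : (S → ℝ) × ℝ → E} {U : Set ((S → ℝ) × ℝ)} (hU : IsOpen U) (ha : cut S a ∈ U)
    (hΨ : ContDiffOn ℝ ∞ Ψ U) (hF : ∀ b, cut S b ∈ U → F b = Ψ (cut S b)) :
    ∃ (Ψ : (T → ℝ) × ℝ → E) (U : Set ((T → ℝ) × ℝ)), IsOpen U ∧ cut T a ∈ U ∧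
      ContDiffOn ℝ ∞ Ψ U ∧ ∀ b, cut T b ∈ U → F b = Ψ (cut T b) :=
  ⟨Ψ ∘ recut h, recut h ⁻¹' U, hU.preimage (recut h).continuous, ha,
    hΨ.comp (recut h).contDiff.contDiffOn fun _ hx => hx, fun b hb => hF b hb⟩

theorem SmAt.continuousAt {F : TimeJet ι → E} {a : TimeJet ι} (hF : SmAt F a) :
    ContinuousAt F a := by
  obtain ⟨S, Ψ, U, hU, haU, hΨ, hFΨ⟩ := hF
  have h1 : ContinuousAt (fun b => Ψ (cut S b)) a :=
    ContinuousAt.comp (g := Ψ) ((hΨ _ haU).contDiffAt (hU.mem_nhds haU)).continuousAt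
      (cut S).continuous.continuousAt
  refine h1.congr ?_
  filter_upwards [(cut S).continuous.continuousAt.eventually_mem (hU.mem_nhds haU)] with b hb
  exact (hFΨ b hb).symm

theorem SmAt.hasLineDerivAt_rep {F : TimeJet ι → E} {a : TimeJet ι} {S : Finset ι}
    {Ψ : (S → ℝ) × ℝ → E} (hF : ∀ᶠ b in 𝓝 a, F b = Ψ (cut S b))
    (hΨ : DifferentiableAt ℝ Ψ (cut S a)) (v : TimeJet ι) :
    HasLineDerivAt ℝ F (fderiv ℝ Ψ (cut S a) (cut S v)) a v := by
  have h1 := hΨ.hasFDerivAt.hasLineDerivAt (cut S v)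
  unfold HasLineDerivAt at *
  refine h1.congr_of_eventuallyEq ?_
  have hc : ContinuousAt (fun s : ℝ => a + s • v) 0 := by fun_prop
  have h0 : a + (0 : ℝ) • v = a := by simp
  have := hc.tendsto.eventually (h0.symm ▸ hF)
  filter_upwards [this] with s hs
  rw [hs, map_add, map_smul]

theorem SmAt.hasLineDerivAt {F : TimeJet ι → E} {a : TimeJet ι} (hF : SmAt F a) (v : TimeJet ι) :
    HasLineDerivAt ℝ F (dd F a v) a v := by
  obtain ⟨S, Ψ, U, hU, haU, hΨ, hFΨ⟩ := hF
  refine LineDifferentiableAt.hasLineDerivAt (HasLineDerivAt.lineDifferentiableAt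
    (SmAt.hasLineDerivAt_rep (S := S) (Ψ := Ψ) ?_ ?_ v))
  · filter_upwards [(cut S).continuous.continuousAt.eventually_mem (hU.mem_nhds haU)] with b hb
    exact hFΨ b hb
  · exact ((hΨ _ haU).contDiffAt (hU.mem_nhds haU)).differentiableAt (by simp)

theorem dd_eq {F : TimeJet ι → E} {a : TimeJet ι} {S : Finset ι} {Ψ : (S → ℝ) × ℝ → E}
    {U : Set ((S → ℝ) × ℝ)} (hU : IsOpen U) (haU : cut S a ∈ U) (hΨ : ContDiffOn ℝ ∞ Ψ U)
    (hFΨ : ∀ b, cut S b ∈ U → F b = Ψ (cut S b)) (v : TimeJet ι) :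
    dd F a v = fderiv ℝ Ψ (cut S a) (cut S v) := by
  refine (SmAt.hasLineDerivAt_rep (S := S) (Ψ := Ψ) ?_ ?_ v).lineDeriv
  · filter_upwards [(cut S).continuous.continuousAt.eventually_mem (hU.mem_nhds haU)] with b hb
    exact hFΨ b hb
  · exact ((hΨ _ haU).contDiffAt (hU.mem_nhds haU)).differentiableAt (by simp)

theorem dd_congr {F G : TimeJet ι → E} {a : TimeJet ι} (h : F =ᶠ[𝓝 a] G) (v : TimeJet ι) :
    dd F a v = dd G a v := by
  have hc : ContinuousAt (fun s : ℝ => a + s • v) 0 := by fun_prop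
  have h0 : a + (0 : ℝ) • v = a := by simp
  have := hc.tendsto.eventually (h0.symm ▸ h)
  exact Filter.EventuallyEq.deriv_eq this

theorem SmAt.exists_linear {F : TimeJet ι → E} {a : TimeJet ι} (hF : SmAt F a) :
    ∃ A : TimeJet ι →ₗ[ℝ] E, ∀ v, dd F a v = A v := by
  obtain ⟨S, Ψ, U, hU, haU, hΨ, hFΨ⟩ := hF
  exact ⟨(fderiv ℝ Ψ (cut S a)).toLinearMap ∘ₗ (cut S).toLinearMap, dd_eq hU haU hΨ hFΨ⟩

theorem SmAt.dd_add {F : TimeJet ι → E} {a : TimeJet ι} (hF : SmAt F a) (v w : TimeJet ι) :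
    dd F a (v + w) = dd F a v + dd F a w := by
  obtain ⟨A, hA⟩ := hF.exists_linear
  simp only [hA, map_add]

theorem SmAt.dd_smul {F : TimeJet ι → E} {a : TimeJet ι} (hF : SmAt F a) (s : ℝ)
    (v : TimeJet ι) : dd F a (s • v) = s • dd F a v := by
  obtain ⟨A, hA⟩ := hF.exists_linear
  simp only [hA, map_smul]

theorem SmAt.dd_sum {F : TimeJet ι → E} {a : TimeJet ι} (hF : SmAt F a) {κ : Type*}
    (s : Finset κ) (v : κ → TimeJet ι) : dd F a (∑ k ∈ s, v k) = ∑ k ∈ s, dd F a (v k) := by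
  obtain ⟨A, hA⟩ := hF.exists_linear
  simp only [hA, map_sum]

theorem smAt_const (x : E) (a : TimeJet ι) : SmAt (fun _ => x) a :=
  ⟨∅, fun _ => x, univ, isOpen_univ, mem_univ _, contDiffOn_const, fun _ _ => rfl⟩

theorem smAt_coord (c : ι) (a : TimeJet ι) : SmAt (fun b : TimeJet ι => b.1 c) a :=
  ⟨{c}, fun x => x.1 ⟨c, by simp⟩, univ, isOpen_univ, mem_univ _, by fun_prop, fun _ _ => rfl⟩

theorem smAt_time (a : TimeJet ι) : SmAt (fun b : TimeJet ι => b.2) a :=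
  ⟨∅, fun x => x.2, univ, isOpen_univ, mem_univ _, by fun_prop, fun _ _ => rfl⟩

theorem dd_const (x : E) (a v : TimeJet ι) : dd (fun _ => x) a v = 0 := by
  simp [dd, lineDeriv]

theorem dd_coord (c : ι) (a v : TimeJet ι) : dd (fun b : TimeJet ι => b.1 c) a v = v.1 c := by
  have : HasLineDerivAt ℝ (fun b : TimeJet ι => b.1 c) (v.1 c) a v := by
    unfold HasLineDerivAt
    simpa using ((hasDerivAt_id (0 : ℝ)).mul_const (v.1 c)).const_add (a.1 c)
  exact this.lineDeriv

theorem SmAt.prodMk {F : TimeJet ι → E} {G : TimeJet ι → E'} {a : TimeJet ι} (hF : SmAt F a)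
    (hG : SmAt G a) : SmAt (fun b => (F b, G b)) a := by
  classical
  obtain ⟨S, Ψ, U, hU, haU, hΨ, hFΨ⟩ := hF
  obtain ⟨S', Ψ', U', hU', haU', hΨ', hFΨ'⟩ := hG
  obtain ⟨Ψ, U, hU, haU, hΨ, hFΨ⟩ :=
    SmAt.enlarge (T := S ∪ S') Finset.subset_union_left hU haU hΨ hFΨ
  obtain ⟨Ψ', U', hU', haU', hΨ', hFΨ'⟩ :=
    SmAt.enlarge (T := S ∪ S') Finset.subset_union_right hU' haU' hΨ' hFΨ'
  exact ⟨S ∪ S', fun x => (Ψ x, Ψ' x), U ∩ U', hU.inter hU', ⟨haU, haU'⟩,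
    (hΨ.mono inter_subset_left).prodMk (hΨ'.mono inter_subset_right),
    fun b hb => Prod.ext (hFΨ b hb.1) (hFΨ' b hb.2)⟩

theorem SmAt.pi {κ : Type*} [Fintype κ] {F : κ → TimeJet ι → E} {a : TimeJet ι}
    (hF : ∀ k, SmAt (F k) a) : SmAt (fun b k => F k b) a := by
  classical
  choose S Ψ U hU haU hΨ hFΨ using hF
  have hS : ∀ k, S k ⊆ Finset.univ.biUnion S := fun k => Finset.subset_biUnion_of_mem S (Finset.mem_univ k)
  choose Ψ' U' hU' haU' hΨ' hFΨ' using fun k => SmAt.enlarge (hS k) (hU k) (haU k) (hΨ k) (hFΨ k)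
  refine ⟨Finset.univ.biUnion S, fun x k => Ψ' k x, ⋂ k, U' k, isOpen_iInter_of_finite hU',
    mem_iInter.2 haU', contDiffOn_pi.2 fun k => (hΨ' k).mono (iInter_subset _ k), fun b hb => ?_⟩
  ext k
  exact hFΨ' k b (mem_iInter.1 hb k)

theorem SmAt.comp_left {F : TimeJet ι → E} {a : TimeJet ι} (hF : SmAt F a) {g : E → E'}
    (hg : ∀ᶠ y in 𝓝 (F a), ContDiffAt ℝ ∞ g y) : SmAt (fun b => g (F b)) a := by
  obtain ⟨O, hOg, hO, haO⟩ := mem_nhds_iff.1 hg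
  obtain ⟨S, Ψ, U, hU, haU, hΨ, hFΨ⟩ := hF
  refine ⟨S, g ∘ Ψ, U ∩ Ψ ⁻¹' O, hΨ.continuousOn.isOpen_inter_preimage hU hO,
    ⟨haU, ?_⟩, ?_, fun b hb => congrArg g (hFΨ b hb.1)⟩
  · rw [mem_preimage, ← hFΨ a haU]
    exact haO
  · have h1 : ContDiffOn ℝ ∞ g O := fun y hy => ContDiffAt.contDiffWithinAt (hOg hy)
    exact h1.comp (hΨ.mono inter_subset_left) fun x hx => hx.2

theorem SmAt.comp_contDiff {F : TimeJet ι → E} {a : TimeJet ι} (hF : SmAt F a) {g : E → E'}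
    (hg : ContDiff ℝ ∞ g) : SmAt (fun b => g (F b)) a :=
  hF.comp_left (Eventually.of_forall fun _ => hg.contDiffAt)

theorem SmAt.add {F G : TimeJet ι → E} {a : TimeJet ι} (hF : SmAt F a) (hG : SmAt G a) :
    SmAt (fun b => F b + G b) a :=
  (hF.prodMk hG).comp_contDiff (g := fun x : E × E => x.1 + x.2) (by fun_prop)

theorem SmAt.sub {F G : TimeJet ι → E} {a : TimeJet ι} (hF : SmAt F a) (hG : SmAt G a) :
    SmAt (fun b => F b - G b) a :=
  (hF.prodMk hG).comp_contDiff (g := fun x : E × E => x.1 - x.2) (by fun_prop)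

theorem SmAt.neg {F : TimeJet ι → E} {a : TimeJet ι} (hF : SmAt F a) :
    SmAt (fun b => -F b) a :=
  hF.comp_contDiff (g := fun x : E => -x) (by fun_prop)

theorem SmAt.mul {F G : TimeJet ι → ℝ} {a : TimeJet ι} (hF : SmAt F a) (hG : SmAt G a) :
    SmAt (fun b => F b * G b) a :=
  (hF.prodMk hG).comp_contDiff (g := fun x : ℝ × ℝ => x.1 * x.2) (by fun_prop)

/-- The chain rule. -/
theorem SmAt.dd_comp_left {F : TimeJet ι → E} {a : TimeJet ι} (hF : SmAt F a) {g : E → E'}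
    (hg : DifferentiableAt ℝ g (F a)) (v : TimeJet ι) :
    dd (fun b => g (F b)) a v = fderiv ℝ g (F a) (dd F a v) := by
  have h := hF.hasLineDerivAt v
  unfold HasLineDerivAt at h
  exact (HasFDerivAt.comp_hasDerivAt_of_eq 0 hg.hasFDerivAt h (by simp)).deriv

theorem SmAt.dd_prodMk {F : TimeJet ι → E} {G : TimeJet ι → E'} {a : TimeJet ι} (hF : SmAt F a)
    (hG : SmAt G a) (v : TimeJet ι) : dd (fun b => (F b, G b)) a v = (dd F a v, dd G a v) :=
  (HasDerivAt.prodMk (hF.hasLineDerivAt v) (hG.hasLineDerivAt v)).deriv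

theorem SmAt.dd_pi {κ : Type*} [Fintype κ] {F : κ → TimeJet ι → E} {a : TimeJet ι}
    (hF : ∀ k, SmAt (F k) a) (v : TimeJet ι) :
    dd (fun b k => F k b) a v = fun k => dd (F k) a v :=
  (hasDerivAt_pi.2 fun k => (hF k).hasLineDerivAt v).deriv

theorem SmAt.dd_fun_add {F G : TimeJet ι → E} {a : TimeJet ι} (hF : SmAt F a) (hG : SmAt G a)
    (v : TimeJet ι) : dd (fun b => F b + G b) a v = dd F a v + dd G a v :=
  (HasDerivAt.add (hF.hasLineDerivAt v) (hG.hasLineDerivAt v)).deriv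

theorem SmAt.dd_fun_sub {F G : TimeJet ι → E} {a : TimeJet ι} (hF : SmAt F a) (hG : SmAt G a)
    (v : TimeJet ι) : dd (fun b => F b - G b) a v = dd F a v - dd G a v :=
  (HasDerivAt.sub (hF.hasLineDerivAt v) (hG.hasLineDerivAt v)).deriv

theorem SmAt.dd_fun_neg {F : TimeJet ι → E} {a : TimeJet ι} (hF : SmAt F a)
    (v : TimeJet ι) : dd (fun b => -F b) a v = -dd F a v :=
  (HasDerivAt.neg (hF.hasLineDerivAt v)).deriv

theorem SmAt.dd_fun_mul {F G : TimeJet ι → ℝ} {a : TimeJet ι} (hF : SmAt F a) (hG : SmAt G a)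
    (v : TimeJet ι) : dd (fun b => F b * G b) a v = dd F a v * G a + F a * dd G a v := by
  refine (HasDerivAt.mul (hF.hasLineDerivAt v) (hG.hasLineDerivAt v)).deriv.trans ?_
  simp

theorem SmAt.dd_fun_sum {κ : Type*} [Fintype κ] {F : κ → TimeJet ι → E} {a : TimeJet ι}
    (hF : ∀ k, SmAt (F k) a) (v : TimeJet ι) :
    dd (fun b => ∑ k, F k b) a v = ∑ k, dd (F k) a v :=
  (HasDerivAt.fun_sum fun k _ => (hF k).hasLineDerivAt v).deriv

/-- A vector field with smooth components. -/
structure SmFieldAt (v : TimeJet ι → TimeJet ι) (a : TimeJet ι) : Prop where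
  coord : ∀ c, SmAt (fun b => (v b).1 c) a
  time : SmAt (fun b => (v b).2) a

theorem SmFieldAt.cut_comp {v : TimeJet ι → TimeJet ι} {a : TimeJet ι} (hv : SmFieldAt v a)
    (S : Finset ι) : SmAt (fun b => cut S (v b)) a :=
  (SmAt.pi (κ := S) fun c => hv.coord c).prodMk hv.time

theorem SmAt.dd_rep {F : TimeJet ι → E} {a : TimeJet ι} {S : Finset ι} {Ψ : (S → ℝ) × ℝ → E}
    {U : Set ((S → ℝ) × ℝ)} (hU : IsOpen U) (haU : cut S a ∈ U) (hΨ : ContDiffOn ℝ ∞ Ψ U)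
    (hFΨ : ∀ b, cut S b ∈ U → F b = Ψ (cut S b)) (v : TimeJet ι → TimeJet ι) :
    (fun b => dd F b (v b)) =ᶠ[𝓝 a]
      fun b => fderiv ℝ Ψ (cut S b) (cut S (v b)) := by
  filter_upwards [(cut S).continuous.continuousAt.eventually_mem (hU.mem_nhds haU)] with b hb
  exact dd_eq hU hb hΨ hFΨ _

theorem smAt_cut (S : Finset ι) (a : TimeJet ι) : SmAt (fun b => cut S b) a :=
  (SmAt.pi (κ := S) fun c => smAt_coord c.1 a).prodMk (smAt_time a)

theorem dd_cut (S : Finset ι) (a v : TimeJet ι) : dd (fun b => cut S b) a v = cut S v := by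
  have : HasLineDerivAt ℝ (fun b => cut S b) (cut S v) a v := by
    unfold HasLineDerivAt
    simp only [map_add, map_smul]
    simpa using ((hasDerivAt_id (0 : ℝ)).smul_const (cut S v)).const_add (cut S a)
  exact this.lineDeriv

theorem contDiffAt_clm_uncurry {Ψ : E' → E} {x y : E'} (h : ∀ᶠ x' in 𝓝 x, ContDiffAt ℝ ∞ Ψ x') :
    ∀ᶠ q in 𝓝 (x, y), ContDiffAt ℝ ∞ (fun q : E' × E' => fderiv ℝ Ψ q.1 q.2) q := by
  filter_upwards [continuous_fst.continuousAt.eventually h] with q hq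
  have h1 : ContDiffAt ℝ ∞ (fderiv ℝ Ψ) q.1 := hq.fderiv_right (by simp)
  exact (h1.comp q contDiffAt_fst).clm_apply contDiffAt_snd

/-- The derivative of a smooth function along a smooth field is smooth. -/
theorem SmAt.dd_field {F : TimeJet ι → E} {a : TimeJet ι} (hF : SmAt F a)
    {v : TimeJet ι → TimeJet ι} (hv : SmFieldAt v a) : SmAt (fun b => dd F b (v b)) a := by
  obtain ⟨S, Ψ, U, hU, haU, hΨ, hFΨ⟩ := hF
  refine SmAt.congr ?_ (SmAt.dd_rep hU haU hΨ hFΨ v)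
  refine ((smAt_cut S a).prodMk (hv.cut_comp S)).comp_left
    (g := fun q : ((S → ℝ) × ℝ) × ((S → ℝ) × ℝ) => fderiv ℝ Ψ q.1 q.2) ?_
  refine contDiffAt_clm_uncurry ?_
  filter_upwards [hU.mem_nhds haU] with x hx using (hΨ x hx).contDiffAt (hU.mem_nhds hx)

/-- The Lie bracket of two fields. -/
def bracket (u v : TimeJet ι → TimeJet ι) (a : TimeJet ι) : TimeJet ι :=
  (fun c => dd (fun b => (v b).1 c) a (u a) - dd (fun b => (u b).1 c) a (v a),
    dd (fun b => (v b).2) a (u a) - dd (fun b => (u b).2) a (v a))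

theorem SmFieldAt.dd_cut {v : TimeJet ι → TimeJet ι} {a : TimeJet ι} (hv : SmFieldAt v a)
    (S : Finset ι) (w : TimeJet ι) : dd (fun b => cut S (v b)) a w =
      (fun c : S => dd (fun b => (v b).1 c) a w, dd (fun b => (v b).2) a w) := by
  have h := SmAt.dd_prodMk (SmAt.pi (κ := S) fun c => hv.coord c) hv.time w
  rw [SmAt.dd_pi fun c : S => hv.coord c] at h
  exact h

/-- The second-order term is symmetric in `v a` and `w`, so it cancels in commutators and only the
derivative of the field survives. -/
theorem SmAt.dd_dd_rep {F : TimeJet ι → E} {a : TimeJet ι} {S : Finset ι} {Ψ : (S → ℝ) × ℝ → E}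
    {U : Set ((S → ℝ) × ℝ)} (hU : IsOpen U) (haU : cut S a ∈ U) (hΨ : ContDiffOn ℝ ∞ Ψ U)
    (hFΨ : ∀ b, cut S b ∈ U → F b = Ψ (cut S b)) {v : TimeJet ι → TimeJet ι}
    (hv : SmFieldAt v a) (w : TimeJet ι) :
    dd (fun b => dd F b (v b)) a w =
      fderiv ℝ (fderiv ℝ Ψ) (cut S a) (cut S w) (cut S (v a)) +
      fderiv ℝ Ψ (cut S a) (dd (fun b => cut S (v b)) a w) := by
  rw [dd_congr (SmAt.dd_rep hU haU hΨ hFΨ v)]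
  have hΨa : ContDiffAt ℝ ∞ Ψ (cut S a) := (hΨ _ haU).contDiffAt (hU.mem_nhds haU)
  have h1 : DifferentiableAt ℝ (fderiv ℝ Ψ) (cut S a) :=
    (hΨa.fderiv_right (m := ∞) (by simp)).differentiableAt (by simp)
  have hs := (smAt_cut S a).prodMk (hv.cut_comp S)
  have hg : HasFDerivAt (fun q : ((S → ℝ) × ℝ) × ((S → ℝ) × ℝ) => fderiv ℝ Ψ q.1 q.2) _
      (cut S a, cut S (v a)) :=
    (HasFDerivAt.comp (cut S a, cut S (v a)) (g := fderiv ℝ Ψ)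
      (f := Prod.fst) h1.hasFDerivAt hasFDerivAt_fst).clm_apply hasFDerivAt_snd
  have h2 := hs.dd_comp_left (g := fun q : ((S → ℝ) × ℝ) × ((S → ℝ) × ℝ) => fderiv ℝ Ψ q.1 q.2)
    hg.differentiableAt w
  rw [h2, hg.fderiv, (smAt_cut S a).dd_prodMk (hv.cut_comp S), dd_cut]
  simp [add_comm]

/-- The commutator of two derivations is the derivation along the bracket. -/
theorem SmAt.dd_comm {F : TimeJet ι → E} {a : TimeJet ι} (hF : SmAt F a)
    {u v : TimeJet ι → TimeJet ι} (hu : SmFieldAt u a) (hv : SmFieldAt v a) :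
    dd (fun b => dd F b (v b)) a (u a) - dd (fun b => dd F b (u b)) a (v a) =
      dd F a (bracket u v a) := by
  obtain ⟨S, Ψ, U, hU, haU, hΨ, hFΨ⟩ := hF
  rw [SmAt.dd_dd_rep hU haU hΨ hFΨ hv, SmAt.dd_dd_rep hU haU hΨ hFΨ hu, dd_eq hU haU hΨ hFΨ,
    hu.dd_cut, hv.dd_cut]
  have hΨa : ContDiffAt ℝ ∞ Ψ (cut S a) := (hΨ _ haU).contDiffAt (hU.mem_nhds haU)
  have hsymm := (hΨa.isSymmSndFDerivAt (by simpa using (by norm_cast : (2 : WithTop ℕ∞) ≤ ∞))).eq (cut S (u a)) (cut S (v a))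
  rw [hsymm, add_sub_add_left_eq_sub, ← map_sub]
  rfl

end Calculus

/-! ### Dependence on a given finite set of coordinates. -/

section Dependence

variable {ι : Type*} {E : Type*} [NormedAddCommGroup E] [NormedSpace ℝ E]

theorem SmAt.exists_dd_single [DecidableEq ι] {F : TimeJet ι → E} {a : TimeJet ι} (hF : SmAt F a) :
    ∃ S : Finset ι, (∀ c ∉ S, dd F a (Pi.single c 1, 0) = 0) ∧
      ∀ v : ι → ℝ, dd F a (v, 0) = ∑ c ∈ S, v c • dd F a (Pi.single c 1, 0) := by
  obtain ⟨S, Ψ, U, hU, haU, hΨ, hFΨ⟩ := hF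
  have h := dd_eq hU haU hΨ hFΨ
  refine ⟨S, fun c hc => ?_, fun v => ?_⟩
  · have h0 : cut S ((Pi.single c 1, 0) : TimeJet ι) = 0 := by
      refine Prod.ext ?_ rfl
      ext d
      have : (d : ι) ≠ c := fun hd => hc (hd ▸ d.2)
      simp [this]
    rw [h, h0, map_zero]
  · have h0 : cut S ((v, 0) : TimeJet ι) =
        ∑ c ∈ S, v c • cut S ((Pi.single c 1, 0) : TimeJet ι) := by
      refine Prod.ext ?_ ?_
      · ext d
        rw [Prod.fst_sum, Finset.sum_apply, Finset.sum_eq_single (d : ι)]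
        · simp
        · intro c _ hc
          simp [hc.symm]
        · intro hd
          exact absurd d.2 hd
      · rw [Prod.snd_sum]
        simp
    simp only [h, h0, map_sum, map_smul]

/-- `F` is a function of time and of the coordinates in `S`. -/
def FactorsThrough {β : Type*} (S : Finset ι) (F : TimeJet ι → β) : Prop :=
  ∀ b b', cut S b = cut S b' → F b = F b'

theorem FactorsThrough.mono {β : Type*} {S T : Finset ι} (h : S ⊆ T) {F : TimeJet ι → β}
    (hF : FactorsThrough S F) : FactorsThrough T F :=
  fun b b' hb => hF b b' (by rw [← recut_cut h, hb, recut_cut])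

/-- The restrictions of `F` to the two lines are the same function of the parameter, so no
differentiability is needed. -/
theorem FactorsThrough.dd {S : Finset ι} {F : TimeJet ι → E} (hF : FactorsThrough S F)
    {b b' v v' : TimeJet ι} (hb : cut S b = cut S b') (hv : cut S v = cut S v') :
    dd F b v = dd F b' v' := by
  unfold LieBacklund.dd lineDeriv
  congr 1
  ext s
  exact hF _ _ (by rw [map_add, map_add, map_smul, map_smul, hb, hv])

/-- The points with the given coordinates in `S`, the others being those of `z`. -/
def extend (S : Finset ι) (z : ι → ℝ) (x : (S → ℝ) × ℝ) : TimeJet ι :=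
  (fun c => open Classical in if h : c ∈ S then x.1 ⟨c, h⟩ else z c, x.2)

theorem cut_extend (S : Finset ι) (z : ι → ℝ) (x : (S → ℝ) × ℝ) : cut S (extend S z x) = x := by
  refine Prod.ext ?_ rfl
  ext c
  simp [extend]

theorem extend_cut (S : Finset ι) (b : TimeJet ι) : extend S b.1 (cut S b) = b := by
  refine Prod.ext ?_ rfl
  ext c
  simp [extend]

theorem contDiff_cut_extend (S T : Finset ι) (z : ι → ℝ) :
    ContDiff ℝ ∞ fun x => cut T (extend S z x) := by
  refine ContDiff.prodMk (contDiff_pi.2 fun c => ?_) contDiff_snd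
  by_cases h : (c : ι) ∈ S
  · have : (fun x : (S → ℝ) × ℝ => (fun i : T => (extend S z x).1 i) c) = fun x => x.1 ⟨c, h⟩ := by
      ext x; simp [extend, h]
    change ContDiff ℝ ∞ (fun x : (S → ℝ) × ℝ => (fun i : T => (extend S z x).1 i) c)
    rw [this]
    fun_prop
  · have : (fun x : (S → ℝ) × ℝ => (fun i : T => (extend S z x).1 i) c) = fun x => z c := by
      ext x; simp [extend, h]
    change ContDiff ℝ ∞ (fun x : (S → ℝ) × ℝ => (fun i : T => (extend S z x).1 i) c)
    rw [this]
    fun_prop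

theorem SmAt.contDiffAt_extend {F : TimeJet ι → E} {a : TimeJet ι} (hF : SmAt F a) (S : Finset ι) :
    ContDiffAt ℝ ∞ (fun x => F (extend S a.1 x)) (cut S a) := by
  obtain ⟨T, Ψ, U, hU, haU, hΨ, hFΨ⟩ := hF
  have h0 : cut T (extend S a.1 (cut S a)) = cut T a := by rw [extend_cut]
  have h1 : ContDiffAt ℝ ∞ (fun x => Ψ (cut T (extend S a.1 x))) (cut S a) := by
    refine ContDiffAt.comp (g := Ψ) (cut S a) ?_ (contDiff_cut_extend S T a.1).contDiffAt
    rw [h0]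
    exact (hΨ _ haU).contDiffAt (hU.mem_nhds haU)
  refine h1.congr_of_eventuallyEq ?_
  have := (contDiff_cut_extend S T a.1).continuous.continuousAt (x := cut S a)
  filter_upwards [this.eventually_mem (by rw [h0]; exact hU.mem_nhds haU)] with x hx
  exact hFΨ _ hx

theorem SmAt.contDiffAt_of_factorsThrough {F : TimeJet ι → E} {a : TimeJet ι} (hF : SmAt F a)
    {S : Finset ι} (hS : FactorsThrough S F) (z : ι → ℝ) :
    ContDiffAt ℝ ∞ (fun x => F (extend S z x)) (cut S a) := by
  have : (fun x => F (extend S z x)) = fun x => F (extend S a.1 x) := by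
    ext x
    exact hS _ _ (by rw [cut_extend, cut_extend])
  rw [this]
  exact hF.contDiffAt_extend S

end Dependence

/-! ### Total derivatives, the field `∂/∂t - X`, and the transport equation. -/

section Fields

variable {n m : ℕ}

/-- The total derivative `D^i`, as a vector field with no time component. -/
def totalVec (i : Fin n) (b : TimeJet (Coord n m)) : TimeJet (Coord n m) :=
  (fun c => match c with
    | Sum.inl j => if j = i then 1 else 0
    | Sum.inr q => b.1 (Sum.inr (q.1, q.2 + Pi.single i 1)), 0)

@[simp] theorem totalVec_inl (i j : Fin n) (b : TimeJet (Coord n m)) :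
    (totalVec i b).1 (Sum.inl j) = if j = i then 1 else 0 := rfl

@[simp] theorem totalVec_inr (i : Fin n) (q : Multipair n m) (b : TimeJet (Coord n m)) :
    (totalVec i b).1 (Sum.inr q) = b.1 (Sum.inr (q.1, q.2 + Pi.single i 1)) := rfl

@[simp] theorem totalVec_snd (i : Fin n) (b : TimeJet (Coord n m)) : (totalVec i b).2 = 0 := rfl

/-- The field `∂/∂t - X`. -/
def transportVec (X : JetField n m) (b : TimeJet (Coord n m)) : TimeJet (Coord n m) :=
  (fun c => -X c b.1, 1)

theorem IsSmoothOn.smAt {W : Set (Jet n m)} (hW : IsOpen W) {F : Jet n m → ℝ}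
    (hF : IsSmoothOn W F) {z : Jet n m} (hz : z ∈ W) (t : ℝ) :
    SmAt (fun b : TimeJet (Coord n m) => F b.1) (z, t) := by
  obtain ⟨S, U, Ψ, hU, hΨ, h⟩ := hF
  refine SmAt.of_eventually S (fun x => Ψ x.1) ?_ ?_
  · filter_upwards [(hU.preimage continuous_fst).mem_nhds (h z hz).1] with x hx
    exact ((hΨ _ hx).contDiffAt (hU.mem_nhds hx)).comp x contDiffAt_fst
  · filter_upwards [(hW.preimage continuous_fst).mem_nhds hz] with b hb
    exact (h b.1 hb).2

theorem partialD_eq_dd (c : Coord n m) (F : Jet n m → ℝ) (z : Jet n m) (t : ℝ) :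
    partialD c F z = dd (fun b : TimeJet (Coord n m) => F b.1) (z, t) (Pi.single c 1, 0) := by
  unfold partialD dd lineDeriv
  have h := deriv_comp_const_add (fun s : ℝ => F (Function.update z c s)) (z c) 0
  rw [add_zero] at h
  rw [← h]
  congr 1
  ext s
  congr 1
  ext d
  by_cases hd : d = c
  · subst hd; simp
  · simp [hd]

theorem totalD_eq_dd (i : Fin n) {F : Jet n m → ℝ} {z : Jet n m} {t : ℝ}
    (hF : SmAt (fun b : TimeJet (Coord n m) => F b.1) (z, t)) :
    totalD i F z = dd (fun b : TimeJet (Coord n m) => F b.1) (z, t) (totalVec i (z, t)) := by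
  obtain ⟨S, hS0, hS⟩ := hF.exists_dd_single
  have h1 : totalVec i ((z, t) : TimeJet (Coord n m)) = ((totalVec i (z, t)).1, 0) := rfl
  rw [h1, hS, totalD]
  -- Enlarging `S` by all the `x_j` separates the sum into the two kinds of coordinates; the added
  -- terms vanish.
  have hsub : S ⊆ (Finset.univ : Finset (Fin n)).disjSum S.toRight := by
    intro c hc
    rcases c with j | q
    · simp
    · simpa using hc
  rw [Finset.sum_subset hsub (fun c _ hc => by rw [hS0 c hc, smul_zero]), Finset.sum_disjSum]
  congr 1
  · rw [Finset.sum_eq_single i]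
    · simp [partialD_eq_dd _ F z t]
    · intro j _ hj
      simp [hj]
    · simp
  · rw [finsum_eq_sum_of_support_subset (s := S.toRight)]
    · simp [partialD_eq_dd _ F z t]
    · intro q hq
      by_contra h
      refine hq ?_
      have : Sum.inr q ∉ S := by simpa using h
      simp only [partialD_eq_dd _ F z t, hS0 _ this, mul_zero]

theorem smFieldAt_totalVec (i : Fin n) (a : TimeJet (Coord n m)) : SmFieldAt (totalVec i) a := by
  refine ⟨fun c => ?_, smAt_const 0 a⟩
  rcases c with j | q
  · exact smAt_const _ a
  · exact smAt_coord _ a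

theorem smFieldAt_transportVec {W : Set (Jet n m)} (hW : IsOpen W) {X : JetField n m}
    (hX : IsLieBacklund W X) {a : TimeJet (Coord n m)} (ha : a.1 ∈ W) :
    SmFieldAt (transportVec X) a :=
  ⟨fun c => ((hX.smooth c).smAt hW ha a.2).neg, smAt_const 1 a⟩

/-- The Lie-Bäcklund condition, as a commutation relation. -/
theorem bracket_transportVec_totalVec {W : Set (Jet n m)} (hW : IsOpen W) {X : JetField n m}
    (hX : IsLieBacklund W X) {a : TimeJet (Coord n m)} (ha : a.1 ∈ W) (i : Fin n) :
    bracket (transportVec X) (totalVec i) a =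
      ∑ j, dd (fun b : TimeJet (Coord n m) => X (Sum.inl j) b.1) a (totalVec i a) • totalVec j a := by
  have hs := fun c => (hX.smooth c).smAt hW ha a.2
  refine Prod.ext ?_ ?_
  · ext c
    rw [Prod.fst_sum, Finset.sum_apply]
    rcases c with l | ⟨L, α⟩
    · simp only [bracket, transportVec, totalVec_inl, (hs _).dd_fun_neg, dd_const]
      simp
    · have hp := hX.prolong a.1 ha L α i
      rw [totalD_eq_dd i (hs _)] at hp
      simp only [totalD_eq_dd i (hs _)] at hp
      simp only [bracket, transportVec, totalVec_inr, (hs _).dd_fun_neg, dd_coord, hp]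
      simp [mul_comm]
  · rw [Prod.snd_sum]
    simp [bracket, transportVec, dd_const]

/-- `G` is a smooth function of finitely many coordinates and time, near time zero, that satisfies
the transport equation `∂G/∂t = X G` and is the coordinate `c` at time zero. -/
structure IsTransported (W : Set (Jet n m)) (X : JetField n m) (c : Coord n m)
    (G : TimeJet (Coord n m) → ℝ) : Prop where
  factors : ∃ S, FactorsThrough S G
  smAt : ∀ z ∈ W, SmAt G (z, 0)
  transport : ∀ z ∈ W, ∀ᶠ b in 𝓝 ((z, 0) : TimeJet (Coord n m)), dd G b (transportVec X b) = 0
  init : ∀ z ∈ W, G (z, 0) = z c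

/-- A direction without time component stays in the slice `t = 0`, where `G` is the coordinate `c`.
-/
theorem IsTransported.dd_init {W : Set (Jet n m)} (hW : IsOpen W) {X : JetField n m}
    {c : Coord n m} {G : TimeJet (Coord n m) → ℝ} (hG : IsTransported W X c G) {z : Jet n m}
    (hz : z ∈ W) (v : Jet n m) : dd G (z, 0) (v, 0) = v c := by
  refine Eq.trans ?_ (dd_coord c ((z, 0) : TimeJet (Coord n m)) (v, 0))
  refine Filter.EventuallyEq.deriv_eq ?_
  have hc : ContinuousAt (fun s : ℝ => z + s • v) 0 := by fun_prop
  filter_upwards [hc.eventually_mem (by simpa using hW.mem_nhds hz)] with s hs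
  have : ((z, 0) : TimeJet (Coord n m)) + s • (v, 0) = (z + s • v, 0) := by
    ext <;> simp
  rw [this]
  exact hG.init _ hs

/-- The derivative of a solution of the transport equation along `D^i`. -/
theorem transport_totalVec {W : Set (Jet n m)} (hW : IsOpen W) {X : JetField n m}
    (hX : IsLieBacklund W X) {G : TimeJet (Coord n m) → ℝ} {a : TimeJet (Coord n m)}
    (ha : a.1 ∈ W) (hG : SmAt G a) (hT : ∀ᶠ b in 𝓝 a, dd G b (transportVec X b) = 0) (i : Fin n) :
    dd (fun b => dd G b (totalVec i b)) a (transportVec X a) =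
      ∑ j, dd (fun b : TimeJet (Coord n m) => X (Sum.inl j) b.1) a (totalVec i a) *
        dd G a (totalVec j a) := by
  have h := hG.dd_comm (smFieldAt_transportVec hW hX ha) (smFieldAt_totalVec i a)
  have h0 : dd (fun b => dd G b (transportVec X b)) a (totalVec i a) = 0 := by
    rw [dd_congr (G := fun _ => 0) hT, dd_const]
  rw [h0, sub_zero, bracket_transportVec_totalVec hW hX ha, hG.dd_sum] at h
  rw [h]
  refine Finset.sum_congr rfl fun j _ => ?_
  rw [hG.dd_smul, smul_eq_mul]

end Fields

/-! ### Prolongation of solutions of the transport equation to all jet coordinates. -/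

section Prolongation

variable {n m : ℕ}

/-- The solution `H` of the linear system `∑_j D^i G_j · H_j = D^i F`, by Cramer's rule. -/
def prolongStep (G : Fin n → TimeJet (Coord n m) → ℝ) (F : TimeJet (Coord n m) → ℝ) (j : Fin n)
    (b : TimeJet (Coord n m)) : ℝ :=
  (Matrix.cramer (Matrix.of fun i l => dd (G l) b (totalVec i b))
    (fun i => dd F b (totalVec i b)) j) /
  (Matrix.of fun i l => dd (G l) b (totalVec i b)).det

theorem contDiff_det (n : ℕ) :
    ContDiff ℝ ∞ fun A : Fin n → Fin n → ℝ => (Matrix.of A).det := by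
  simp only [Matrix.det_apply]
  refine ContDiff.sum fun σ _ => ?_
  refine ContDiff.const_smul _ (contDiff_prod fun i _ => ?_)
  exact (contDiff_apply_apply ℝ ℝ (σ i) i)

theorem smAt_prolongStep {G : Fin n → TimeJet (Coord n m) → ℝ} {F : TimeJet (Coord n m) → ℝ}
    {a : TimeJet (Coord n m)} (hG : ∀ l, SmAt (G l) a) (hF : SmAt F a)
    (hdet : (Matrix.of fun i l => dd (G l) a (totalVec i a)).det ≠ 0) (j : Fin n) :
    SmAt (prolongStep G F j) a := by
  have hA : SmAt (fun b i l => dd (G l) b (totalVec i b)) a :=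
    SmAt.pi fun i => SmAt.pi fun l => (hG l).dd_field (smFieldAt_totalVec i a)
  have hv : SmAt (fun b i => dd F b (totalVec i b)) a :=
    SmAt.pi fun i => hF.dd_field (smFieldAt_totalVec i a)
  refine (hA.prodMk hv).comp_left (g := fun q : (Fin n → Fin n → ℝ) × (Fin n → ℝ) =>
    (Matrix.cramer (Matrix.of q.1) q.2 j) / (Matrix.of q.1).det) ?_
  have hd : Continuous fun q : (Fin n → Fin n → ℝ) × (Fin n → ℝ) => (Matrix.of q.1).det :=
    (contDiff_det n).continuous.comp continuous_fst
  filter_upwards [hd.continuousAt.eventually_ne hdet] with q hq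
  refine ContDiffAt.div ?_ ((contDiff_det n).comp contDiff_fst).contDiffAt hq
  refine ContDiff.contDiffAt ?_
  have : (fun q : (Fin n → Fin n → ℝ) × (Fin n → ℝ) => Matrix.cramer (Matrix.of q.1) q.2 j) =
      fun q => (Matrix.of fun i l => if l = j then q.2 i else q.1 i l).det := by
    ext q
    rw [Matrix.cramer_apply]
    congr 1
    ext i l
    simp [Matrix.updateCol_apply]
  rw [this]
  refine (contDiff_det n).comp (contDiff_pi.2 fun i => contDiff_pi.2 fun l => ?_)
  by_cases h : l = j
  · simp only [h, if_true]; fun_prop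
  · simp only [h, if_false]; fun_prop

theorem prolongStep_spec {G : Fin n → TimeJet (Coord n m) → ℝ} {F : TimeJet (Coord n m) → ℝ}
    {b : TimeJet (Coord n m)}
    (hdet : (Matrix.of fun i l => dd (G l) b (totalVec i b)).det ≠ 0) (i : Fin n) :
    ∑ l, dd (G l) b (totalVec i b) * prolongStep G F l b = dd F b (totalVec i b) := by
  have h := congrFun (Matrix.mulVec_cramer (Matrix.of fun i l => dd (G l) b (totalVec i b))
    (fun i => dd F b (totalVec i b))) i
  simp only [Matrix.mulVec, dotProduct, Matrix.of_apply, Pi.smul_apply, smul_eq_mul] at h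
  simp only [prolongStep, ← mul_div_assoc, ← Finset.sum_div]
  rw [h]
  field_simp

theorem factorsThrough_dd_totalVec {S : Finset (Coord n m)} {F : TimeJet (Coord n m) → ℝ}
    (hF : FactorsThrough S F) (i : Fin n) :
    ∃ T, FactorsThrough T fun b => dd F b (totalVec i b) := by
  classical
  refine ⟨S ∪ S.image (Sum.map id fun q => (q.1, q.2 + Pi.single i 1)), fun b b' h => ?_⟩
  have hb : ∀ c ∈ S ∪ S.image (Sum.map id fun q => (q.1, q.2 + Pi.single i 1)), b.1 c = b'.1 c :=
    fun c hc => congrFun (congrArg Prod.fst h) ⟨c, hc⟩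
  have ht : (cut (S ∪ S.image (Sum.map id fun q => (q.1, q.2 + Pi.single i 1))) b).2 =
      (cut (S ∪ S.image (Sum.map id fun q => (q.1, q.2 + Pi.single i 1))) b').2 := congrArg Prod.snd h
  refine hF.dd (Prod.ext ?_ ht) (Prod.ext ?_ rfl)
  · ext c
    exact hb c (Finset.mem_union_left _ c.2)
  · ext ⟨c, hc⟩
    rcases c with j | q
    · rfl
    · exact hb _ (Finset.mem_union_right _ (Finset.mem_image_of_mem _ hc))

/-- Cramer's formula involves finitely many total derivatives. With division by zero having a fixed
value, the dependence is global, also where the determinant vanishes. -/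
theorem factorsThrough_prolongStep {G : Fin n → TimeJet (Coord n m) → ℝ}
    {F : TimeJet (Coord n m) → ℝ} (hG : ∀ l, ∃ S, FactorsThrough S (G l))
    (hF : ∃ S, FactorsThrough S F) (j : Fin n) : ∃ S, FactorsThrough S (prolongStep G F j) := by
  classical
  have h1 : ∀ i l, ∃ T, FactorsThrough T fun b => dd (G l) b (totalVec i b) := fun i l =>
    (hG l).elim fun S hS => factorsThrough_dd_totalVec hS i
  have h2 : ∀ i : Fin n, ∃ T, FactorsThrough T fun b => dd F b (totalVec i b) := fun i =>
    hF.elim fun S hS => factorsThrough_dd_totalVec hS i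
  choose T hT using h1
  choose T' hT' using h2
  refine ⟨(Finset.univ.biUnion fun i => Finset.univ.biUnion (T i)) ∪ Finset.univ.biUnion T',
    fun b b' h => ?_⟩
  have e1 : ∀ i l, dd (G l) b (totalVec i b) = dd (G l) b' (totalVec i b') := fun i l =>
    (hT i l).mono (((Finset.subset_biUnion_of_mem (T i) (Finset.mem_univ l)).trans
      (Finset.subset_biUnion_of_mem (fun i => Finset.univ.biUnion (T i)) (Finset.mem_univ i))).trans
      Finset.subset_union_left) b b' h
  have e2 : ∀ i : Fin n, dd F b (totalVec i b) = dd F b' (totalVec i b') := fun i =>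
    (hT' i).mono ((Finset.subset_biUnion_of_mem T' (Finset.mem_univ i)).trans
      Finset.subset_union_right) b b' h
  simp only [prolongStep, e1, e2]

/-- Prolongation of solutions of the transport equation. -/
theorem IsTransported.prolongStep {W : Set (Jet n m)} (hW : IsOpen W) {X : JetField n m}
    (hX : IsLieBacklund W X) {G : Fin n → TimeJet (Coord n m) → ℝ}
    (hG : ∀ l, IsTransported W X (Sum.inl l) (G l)) {L : Fin m} {α : Fin n → ℕ}
    {F : TimeJet (Coord n m) → ℝ} (hF : IsTransported W X (Sum.inr (L, α)) F) (j : Fin n) :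
    IsTransported W X (Sum.inr (L, α + Pi.single j 1)) (prolongStep G F j) := by
  have hA0 : ∀ z ∈ W, ∀ i l, dd (G l) (z, 0) (totalVec i (z, 0)) = if l = i then 1 else 0 :=
    fun z hz i l => (hG l).dd_init hW hz _
  have hF0 : ∀ z ∈ W, ∀ i, dd F (z, 0) (totalVec i (z, 0)) =
      z (Sum.inr (L, α + Pi.single i 1)) := fun z hz i => hF.dd_init hW hz _
  have hone : ∀ z ∈ W, (Matrix.of fun i l => dd (G l) (z, 0) (totalVec i (z, 0))) = 1 := by
    intro z hz
    ext i l
    rw [Matrix.of_apply, hA0 z hz, Matrix.one_apply]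
    simp [eq_comm]
  have hdet0 : ∀ z ∈ W, (Matrix.of fun i l => dd (G l) (z, 0) (totalVec i (z, 0))).det ≠ 0 := by
    intro z hz
    rw [hone z hz, Matrix.det_one]
    exact one_ne_zero
  refine ⟨factorsThrough_prolongStep (fun l => (hG l).factors) hF.factors j,
    fun z hz => smAt_prolongStep (fun l => (hG l).smAt z hz) (hF.smAt z hz) (hdet0 z hz) j,
    fun z hz => ?_, fun z hz => ?_⟩
  · have hAs : SmAt (fun b i l => dd (G l) b (totalVec i b)) (z, 0) :=
      SmAt.pi fun i => SmAt.pi fun l => ((hG l).smAt z hz).dd_field (smFieldAt_totalVec i _)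
    have hdet : ∀ᶠ b in 𝓝 ((z, 0) : TimeJet (Coord n m)),
        (Matrix.of fun i l => dd (G l) b (totalVec i b)).det ≠ 0 :=
      (hAs.comp_contDiff (contDiff_det n)).continuousAt.eventually_ne (hdet0 z hz)
    have hWe : ∀ᶠ b in 𝓝 ((z, 0) : TimeJet (Coord n m)), b.1 ∈ W :=
      (hW.preimage continuous_fst).mem_nhds hz
    have hGe : ∀ᶠ b in 𝓝 ((z, 0) : TimeJet (Coord n m)), ∀ l, SmAt (G l) b :=
      eventually_all.2 fun l => ((hG l).smAt z hz).eventually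
    have hGt : ∀ᶠ b in 𝓝 ((z, 0) : TimeJet (Coord n m)), ∀ l, ∀ᶠ b' in 𝓝 b,
        dd (G l) b' (transportVec X b') = 0 :=
      eventually_all.2 fun l => eventually_eventually_nhds.2 ((hG l).transport z hz)
    filter_upwards [eventually_eventually_nhds.2 hdet, hWe, hGe, hGt, (hF.smAt z hz).eventually,
      eventually_eventually_nhds.2 (hF.transport z hz)] with b hdb hb hGb hGtb hFb hFtb
    set A := Matrix.of fun i l => dd (G l) b (totalVec i b) with hA
    set T := transportVec X b with hT
    have hH : ∀ l, SmAt (LieBacklund.prolongStep G F l) b := smAt_prolongStep hGb hFb hdb.self_of_nhds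
    -- Apply `T` to `∑_l D^i G_l · H_l = D^i F`. By the commutation relation the terms with `T(D^i
    -- G_l)` sum to `∑_j D^i ξ_j · D^j F`, which is also `T(D^i F)`; what remains is `A (T H) = 0`,
    -- with `A` invertible.
    have hmul : A.mulVec (fun l => dd (LieBacklund.prolongStep G F l) b T) = 0 := by
      ext i
      have hGi : ∀ l, SmAt (fun b => dd (G l) b (totalVec i b)) b := fun l =>
        (hGb l).dd_field (smFieldAt_totalVec i _)
      have h1 : dd (fun b => ∑ l, dd (G l) b (totalVec i b) * LieBacklund.prolongStep G F l b) b T =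
          dd (fun b => dd F b (totalVec i b)) b T := by
        refine dd_congr ?_ _
        filter_upwards [hdb] with b' hb' using prolongStep_spec hb' i
      rw [SmAt.dd_fun_sum fun l => (hGi l).mul (hH l)] at h1
      rw [Finset.sum_congr rfl fun l _ => (hGi l).dd_fun_mul (hH l) T] at h1
      rw [transport_totalVec hW hX hb hFb hFtb] at h1
      rw [Finset.sum_congr rfl fun l _ => congrArg₂ (· + ·) (congrArg (· * LieBacklund.prolongStep G F l b)
        (transport_totalVec hW hX hb (hGb l) (hGtb l) i)) rfl] at h1
      rw [Finset.sum_add_distrib] at h1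
      simp only [Finset.sum_mul] at h1
      rw [Finset.sum_comm] at h1
      simp only [mul_assoc, ← Finset.mul_sum, prolongStep_spec hdb.self_of_nhds] at h1
      simpa [Matrix.mulVec, dotProduct, hA] using h1
    exact congrFun (Matrix.eq_zero_of_mulVec_eq_zero hdb.self_of_nhds hmul) j
  · have h := fun i => prolongStep_spec (F := F) (hdet0 z hz) i
    have := h j
    simpa [hA0 z hz, hF0 z hz] using this

theorem exists_eq_add_single {α : Fin n → ℕ} {N : ℕ} (hN : len α = N + 1) :
    ∃ (i : Fin n) (β : Fin n → ℕ), len β = N ∧ α = β + Pi.single i 1 := by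
  obtain ⟨i, hi⟩ : ∃ i, α i ≠ 0 := by
    by_contra! h
    simp [len, h] at hN
  have hle : Pi.single i 1 ≤ α := by
    intro j
    by_cases hj : j = i
    · subst hj; simpa using Nat.one_le_iff_ne_zero.2 hi
    · simp [hj]
  obtain ⟨β, rfl⟩ : ∃ β, α = β + Pi.single i 1 :=
    ⟨α - Pi.single i 1, (tsub_add_cancel_of_le hle).symm⟩
  refine ⟨i, β, ?_, rfl⟩
  simp only [len, Pi.add_apply, Finset.sum_add_distrib, Finset.sum_pi_single'] at hN ⊢
  simpa using hN

/-- If the principal coordinates have solutions of the transport equation, so have all. -/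
theorem exists_isTransported {W : Set (Jet n m)} (hW : IsOpen W) {X : JetField n m}
    (hX : IsLieBacklund W X) (hx : ∀ l : Fin n, ∃ G, IsTransported W X (Sum.inl l) G)
    (hy : ∀ L : Fin m, ∃ G, IsTransported W X (Sum.inr (L, 0)) G) (c : Coord n m) :
    ∃ G, IsTransported W X c G := by
  choose G hG using hx
  rcases c with l | ⟨L, α⟩
  · exact ⟨G l, hG l⟩
  · induction hN : len α generalizing α with
    | zero =>
      have : α = 0 := by
        ext i
        have := Finset.sum_eq_zero_iff.1 hN i (Finset.mem_univ i)
        simpa using this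
      rw [this]
      exact hy L
    | succ N ih =>
      obtain ⟨i, β, hβ, rfl⟩ := exists_eq_add_single hN
      obtain ⟨F, hF⟩ := ih β hβ
      exact ⟨_, IsTransported.prolongStep hW hX hG hF i⟩

end Prolongation

/-! ### Polynomial dependence on the coordinates of order greater than `k`. -/

section FibrePolynomials

variable {n m k : ℕ}

theorem continuous_jetProj : Continuous (jetProj k : Jet n m → FinJet n m k) :=
  continuous_pi fun c => continuous_apply c.1

@[simp] theorem jetProj_glue (p : FinJet n m k) (w : HighCoord n m k → ℝ) :
    jetProj k (glue k p w) = p := by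
  ext c
  simp [jetProj, glue]

theorem glue_jetProj (z : Jet n m) : glue k (jetProj k z) (fun c => z c) = z := by
  ext c
  by_cases h : c ∈ lowCoords n m k <;> simp [glue, jetProj, h]

/-- The algebra generated by the smooth functions on `V ⊆ J^k` and the coordinates. -/
inductive FibrePoly (V : Set (FinJet n m k)) : (Jet n m → ℝ) → Prop
  | base (a : FinJet n m k → ℝ) (ha : ContDiffOn ℝ ∞ a V) : FibrePoly V fun z => a (jetProj k z)
  | coord (c : Coord n m) : FibrePoly V fun z => z c
  | add {F G : Jet n m → ℝ} (hF : FibrePoly V F) (hG : FibrePoly V G) :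
      FibrePoly V fun z => F z + G z
  | mul {F G : Jet n m → ℝ} (hF : FibrePoly V F) (hG : FibrePoly V G) :
      FibrePoly V fun z => F z * G z

namespace FibrePoly

variable {V : Set (FinJet n m k)} {F : Jet n m → ℝ}

theorem const (x : ℝ) : FibrePoly V fun _ => x := base (fun _ => x) contDiffOn_const

theorem sum {κ : Type*} (s : Finset κ) {F : κ → Jet n m → ℝ} (hF : ∀ i, FibrePoly V (F i)) :
    FibrePoly V fun z => ∑ i ∈ s, F i z := by
  classical
  induction s using Finset.induction_on with
  | empty => simpa using const 0
  | insert i s hi ih =>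
    simp only [Finset.sum_insert hi]
    exact (hF i).add ih

theorem smAt (hV : IsOpen V) (hF : FibrePoly V F) {a : TimeJet (Coord n m)}
    (ha : a.1 ∈ jetProj k ⁻¹' V) : SmAt (fun b : TimeJet (Coord n m) => F b.1) a := by
  induction hF with
  | base f hf =>
    exact ⟨lowCoords n m k, fun x => f x.1, Prod.fst ⁻¹' V, hV.preimage continuous_fst, ha,
      hf.comp contDiff_fst.contDiffOn fun _ hx => hx, fun _ _ => rfl⟩
  | coord c => exact smAt_coord c a
  | add _ _ h1 h2 => exact h1.add h2
  | mul _ _ h1 h2 => exact h1.mul h2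

theorem totalVec_coord (i : Fin n) (c : Coord n m) :
    FibrePoly V fun z => (totalVec i ((z, 0) : TimeJet (Coord n m))).1 c := by
  rcases c with j | q
  · exact const _
  · exact coord _

/-- The algebra is closed under total derivatives. -/
theorem exists_dd (hV : IsOpen V) (hF : FibrePoly V F) (i : Fin n) :
    ∃ F', FibrePoly V F' ∧ ∀ a : TimeJet (Coord n m), a.1 ∈ jetProj k ⁻¹' V →
      dd (fun b : TimeJet (Coord n m) => F b.1) a (totalVec i a) = F' a.1 := by
  induction hF with
  | base f hf =>
    refine ⟨fun z => ∑ c : lowCoords n m k, (totalVec i ((z, 0) : TimeJet (Coord n m))).1 c *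
      fderiv ℝ f (jetProj k z) (Pi.single c 1), sum _ fun c => (totalVec_coord i c.1).mul
        (base (fun p => fderiv ℝ f p (Pi.single c 1)) ?_), ?_⟩
    · exact (hf.fderiv_of_isOpen hV (m := ∞) (by simp)).clm_apply contDiffOn_const
    · intro a ha
      have hfa : DifferentiableAt ℝ f (jetProj k a.1) :=
        ((hf _ ha).contDiffAt (hV.mem_nhds ha)).differentiableAt (by simp)
      rw [dd_eq (F := fun b : TimeJet (Coord n m) => f (jetProj k b.1)) (S := lowCoords n m k)
        (Ψ := fun x => f x.1) (hV.preimage continuous_fst) ha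
        (hf.comp contDiff_fst.contDiffOn fun _ hx => hx) (fun _ _ => rfl)]
      have h1 : HasFDerivAt (fun x : FinJet n m k × ℝ => f x.1)
          (fderiv ℝ f (jetProj k a.1) ∘L ContinuousLinearMap.fst ℝ _ _) (cut (lowCoords n m k) a) :=
        HasFDerivAt.comp (cut (lowCoords n m k) a) (g := f) (f := Prod.fst)
          hfa.hasFDerivAt hasFDerivAt_fst
      rw [h1.fderiv]
      have h2 : (cut (lowCoords n m k) (totalVec i a)).1 = ∑ c : lowCoords n m k,
          (totalVec i ((a.1, 0) : TimeJet (Coord n m))).1 c • (Pi.single c 1 : FinJet n m k) := by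
        ext c
        rw [Finset.sum_apply, Finset.sum_eq_single c]
        · simp only [cut_apply_fst, Pi.smul_apply, Pi.single_eq_same, smul_eq_mul, mul_one]
          rfl
        · intro d _ hd
          simp [hd.symm]
        · simp
      rw [ContinuousLinearMap.comp_apply, ContinuousLinearMap.coe_fst', h2, map_sum]
      simp only [map_smul, smul_eq_mul]
  | coord c =>
    exact ⟨_, totalVec_coord i c, fun a _ => dd_coord c a _⟩
  | add h1 h2 ih1 ih2 =>
    obtain ⟨F', hF', e1⟩ := ih1
    obtain ⟨G', hG', e2⟩ := ih2
    exact ⟨_, hF'.add hG', fun a ha => by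
      rw [(h1.smAt hV ha).dd_fun_add (h2.smAt hV ha), e1 a ha, e2 a ha]⟩
  | mul h1 h2 ih1 ih2 =>
    obtain ⟨F', hF', e1⟩ := ih1
    obtain ⟨G', hG', e2⟩ := ih2
    exact ⟨_, (hF'.mul h2).add (h1.mul hG'), fun a ha => by
      rw [(h1.smAt hV ha).dd_fun_mul (h2.smAt hV ha), e1 a ha, e2 a ha]⟩

/-- On a fibre of `J^∞ → J^k` one has a polynomial. -/
theorem exists_polynomial (hF : FibrePoly V F) (p : FinJet n m k) :
    ∃ P : MvPolynomial (HighCoord n m k) ℝ, ∀ w, MvPolynomial.eval w P = F (glue k p w) := by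
  induction hF with
  | base f hf => exact ⟨MvPolynomial.C (f p), fun w => by simp⟩
  | coord c =>
    by_cases h : c ∈ lowCoords n m k
    · exact ⟨MvPolynomial.C (p ⟨c, h⟩), fun w => by simp [glue, h]⟩
    · exact ⟨MvPolynomial.X ⟨c, h⟩, fun w => by simp [glue, h]⟩
  | add _ _ h1 h2 =>
    obtain ⟨P, hP⟩ := h1
    obtain ⟨Q, hQ⟩ := h2
    exact ⟨P + Q, fun w => by simp [hP, hQ]⟩
  | mul _ _ h1 h2 =>
    obtain ⟨P, hP⟩ := h1
    obtain ⟨Q, hQ⟩ := h2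
    exact ⟨P * Q, fun w => by simp [hP, hQ]⟩

end FibrePoly

variable {V : Set (FinJet n m k)}

theorem isOpen_preimage_jetProj (hV : IsOpen V) : IsOpen (jetProj k ⁻¹' V : Set (Jet n m)) :=
  hV.preimage continuous_jetProj

/-- A function without derivatives along the coordinates of order greater than `k` does not depend
on them. -/
theorem eq_glue_zero (hV : IsOpen V) {F : Jet n m → ℝ} (hF : IsSmoothOn (jetProj k ⁻¹' V) F)
    (h0 : ∀ c ∉ lowCoords n m k, ∀ z ∈ jetProj k ⁻¹' V, partialD c F z = 0) {z : Jet n m}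
    (hz : z ∈ jetProj k ⁻¹' V) : F z = F (glue k (jetProj k z) 0) := by
  -- The segment from the zero point of the fibre to `z` moves only in coordinates of order greater
  -- than `k`, and stays over `p ∈ V`.
  set p := jetProj k z with hp
  set u : Jet n m := glue k 0 (fun c => z c) with hu
  have hline : ∀ s : ℝ, glue k p 0 + s • u = glue k p (s • fun c : HighCoord n m k => z c) := by
    intro s
    ext c
    by_cases h : c ∈ lowCoords n m k <;> simp [glue, hu, h]
  have hmem : ∀ s : ℝ, glue k p 0 + s • u ∈ jetProj k ⁻¹' V := by
    intro s
    rw [hline, mem_preimage, jetProj_glue]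
    exact hz
  have hd : ∀ s : ℝ, HasDerivAt (fun s : ℝ => F (glue k p 0 + s • u)) 0 s := by
    intro s
    have hs := hF.smAt (isOpen_preimage_jetProj hV) (hmem s) 0
    have h1 := hs.hasLineDerivAt (u, 0)
    have h2 : dd (fun b : TimeJet (Coord n m) => F b.1) (glue k p 0 + s • u, 0) (u, 0) = 0 := by
      obtain ⟨S, -, hS⟩ := hs.exists_dd_single
      rw [hS]
      refine Finset.sum_eq_zero fun c _ => ?_
      by_cases h : c ∈ lowCoords n m k
      · simp [hu, glue, h]
      · rw [← partialD_eq_dd, h0 c h _ (hmem s), smul_zero]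
    rw [h2] at h1
    unfold HasLineDerivAt at h1
    have h3 := HasDerivAt.comp_sub_const s s (f := fun r : ℝ => F (glue k p 0 + s • u + r • u)) (f' := 0)
      (by simpa using h1)
    refine h3.congr_of_eventuallyEq (Eventually.of_forall fun r => ?_)
    change F _ = F _
    rw [add_assoc, ← add_smul, add_sub_cancel]
  have := is_const_of_deriv_eq_zero (fun s => (hd s).differentiableAt) (fun s => (hd s).deriv) 1 0
  have h1 : glue k p 0 + u = z := by
    rw [← one_smul ℝ u, hline, one_smul]
    exact glue_jetProj z
  rwa [one_smul, zero_smul, add_zero, h1] at this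

theorem IsSmoothOn.contDiffOn_glue_zero {F : Jet n m → ℝ}
    (hF : IsSmoothOn (jetProj k ⁻¹' V) F) :
    ContDiffOn ℝ ∞ (fun p : FinJet n m k => F (glue k p 0)) V := by
  obtain ⟨S, U, Ψ, hU, hΨ, h⟩ := hF
  have hmem : ∀ p ∈ V, glue k p (0 : HighCoord n m k → ℝ) ∈ (jetProj k ⁻¹' V : Set (Jet n m)) := by
    intro p hp
    rwa [mem_preimage, jetProj_glue]
  have hg : ContDiff ℝ ∞ fun p : FinJet n m k =>
      S.restrict (glue k p (0 : HighCoord n m k → ℝ)) := by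
    refine contDiff_pi.2 fun c => ?_
    by_cases hc : (c : Coord n m) ∈ lowCoords n m k
    · simp only [Finset.restrict, glue, hc, dif_pos]
      fun_prop
    · simp only [Finset.restrict, glue, hc, dif_neg, not_false_iff]
      fun_prop
  exact (hΨ.comp hg.contDiffOn fun p hp => (h _ (hmem p hp)).1).congr
    fun p hp => (h _ (hmem p hp)).2

theorem coordOrder_le_of_mem {A : Finset (Multipair n m)} {q : Multipair n m} (hq : q ∈ A) :
    len q.2 ≤ setOrder A :=
  Finset.le_sup (f := fun q : Multipair n m => len q.2) hq

/-- The components of a Lie-Bäcklund field are polynomials on the fibres of `J^∞ → J^k`. -/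
theorem IsLieBacklund.exists_fibrePoly (hV : IsOpen V) {X : JetField n m}
    (hX : IsLieBacklund (jetProj k ⁻¹' V) X)
    (hξ : ∀ j : Fin n, ∀ z ∈ jetProj k ⁻¹' V,
      X (Sum.inl j) z = X (Sum.inl j) (glue k (jetProj k z) 0))
    (hη : ∀ L : Fin m, ∀ z ∈ jetProj k ⁻¹' V,
      X (Sum.inr (L, 0)) z = X (Sum.inr (L, 0)) (glue k (jetProj k z) 0)) (c : Coord n m) :
    ∃ F, FibrePoly V F ∧ ∀ z ∈ jetProj k ⁻¹' V, X c z = F z := by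
  have hW := isOpen_preimage_jetProj (n := n) (m := m) hV
  have hbase : ∀ c, FibrePoly V fun z => X c (glue k (jetProj k z) 0) := fun c =>
    FibrePoly.base _ (hX.smooth c).contDiffOn_glue_zero
  have htot : ∀ c, (∃ F, FibrePoly V F ∧ ∀ z ∈ jetProj k ⁻¹' V, X c z = F z) → ∀ i : Fin n,
      ∃ F', FibrePoly V F' ∧ ∀ z ∈ jetProj k ⁻¹' V, totalD i (X c) z = F' z := by
    rintro c ⟨F, hF, hXF⟩ i
    obtain ⟨F', hF', h'⟩ := hF.exists_dd hV i
    refine ⟨F', hF', fun z hz => ?_⟩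
    rw [totalD_eq_dd (t := 0) i ((hX.smooth c).smAt hW hz 0), ← h' (z, 0) hz]
    refine dd_congr ?_ _
    filter_upwards [(hW.preimage continuous_fst).mem_nhds hz] with b hb using hXF b.1 hb
  rcases c with j | ⟨L, α⟩
  · exact ⟨_, hbase _, hξ j⟩
  · induction hN : len α generalizing α with
    | zero =>
      have : α = 0 := by
        ext i
        have := Finset.sum_eq_zero_iff.1 hN i (Finset.mem_univ i)
        simpa using this
      rw [this]
      exact ⟨_, hbase _, hη L⟩
    | succ N ih =>
      obtain ⟨i, β, hβ, rfl⟩ := exists_eq_add_single hN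
      obtain ⟨F', hF', h'⟩ := htot _ (ih β hβ) i
      choose ξ' hξ' hξe using fun j : Fin n => htot (Sum.inl j) ⟨_, hbase _, hξ j⟩ i
      refine ⟨_, hF'.add ((FibrePoly.const (-1)).mul (FibrePoly.sum Finset.univ fun j =>
        (FibrePoly.coord (Sum.inr (L, β + Pi.single j 1))).mul (hξ' j))), fun z hz => ?_⟩
      rw [hX.prolong z hz, h' z hz]
      simp only [hξe _ z hz]
      ring

end FibrePolynomials

/-! ### From condition (⋆) to the transport equation for the principal coordinates. -/

section PrincipalFlow

variable {n m k : ℕ} {V : Set (FinJet n m k)}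

/-- The field `X` in `J^k`: the truncated field and the fields `Y_ℓ` with their monomials. -/
theorem exists_sum_coeffField {X : JetField n m}
    (hξ : ∀ j : Fin n, ∀ z ∈ jetProj k ⁻¹' V,
      X (Sum.inl j) z = X (Sum.inl j) (glue k (jetProj k z) 0))
    (hpoly : ∀ c, ∃ F, FibrePoly V F ∧ ∀ z ∈ jetProj k ⁻¹' V, X c z = F z) {z : Jet n m}
    (hz : z ∈ jetProj k ⁻¹' V) :
    ∃ (Λ : Finset (HighCoord n m k →₀ ℕ)) (μ : (HighCoord n m k →₀ ℕ) → ℝ), 0 ∉ Λ ∧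
      (fun c : lowCoords n m k => X c z) = truncField X k (jetProj k z) +
        ∑ ℓ ∈ Λ, μ ℓ • coeffField X k ℓ (jetProj k z) := by
  classical
  set p := jetProj k z with hp
  set w : HighCoord n m k → ℝ := fun c => z c with hw
  have hzg : glue k p w = z := glue_jetProj z
  have hP : ∀ c : lowCoords n m k, ∀ w', MvPolynomial.eval w' (highPoly X k c p) =
      X c (glue k p w') := by
    intro c w'
    obtain ⟨F, hF, hXF⟩ := hpoly c
    obtain ⟨P, hP⟩ := hF.exists_polynomial p
    have hP' : ∀ w', MvPolynomial.eval w' P = X c (glue k p w') := fun w' => by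
      rw [hP, hXF _ (by rw [mem_preimage, jetProj_glue]; exact hz)]
    rw [highPoly_eq hP', hP']
  -- All nonconstant exponents that occur at `p` in some component of order at most `k`; `μ ℓ` is
  -- the value of the monomial at `z`.
  refine ⟨(Finset.univ.biUnion fun c : lowCoords n m k => (highPoly X k c p).support).erase 0,
    fun ℓ => ∏ i ∈ ℓ.support, w i ^ ℓ i, Finset.notMem_erase _ _, ?_⟩
  ext ⟨c, hc⟩
  rw [Pi.add_apply, Finset.sum_apply]
  rcases c with j | q
  · simp only [Pi.smul_apply, coeffField, smul_zero, Finset.sum_const_zero, add_zero]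
    exact hξ j z hz
  · have h1 := hP ⟨Sum.inr q, hc⟩ w
    rw [hzg, MvPolynomial.eval_eq] at h1
    have h2 := hP ⟨Sum.inr q, hc⟩ 0
    have h3 : MvPolynomial.eval 0 (highPoly X k (Sum.inr q) p) =
        (highPoly X k (Sum.inr q) p).coeff 0 := by
      rw [MvPolynomial.eval_zero]; rfl
    have hsub : (highPoly X k (Sum.inr q) p).support ⊆ insert 0
        ((Finset.univ.biUnion fun c : lowCoords n m k => (highPoly X k c p).support).erase 0) := by
      intro ℓ hℓ
      by_cases h : ℓ = 0
      · simp [h]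
      · refine Finset.mem_insert_of_mem (Finset.mem_erase.2 ⟨h, Finset.mem_biUnion.2
          ⟨⟨Sum.inr q, hc⟩, Finset.mem_univ _, hℓ⟩⟩)
    rw [Finset.sum_subset hsub (fun ℓ _ hℓ => by
      rw [MvPolynomial.notMem_support_iff.1 hℓ, zero_mul]),
      Finset.sum_insert (Finset.notMem_erase _ _)] at h1
    change X (Sum.inr q) z = _
    rw [← h1]
    congr 1
    · change _ = X (Sum.inr q) (glue k p 0)
      rw [← h2, h3]
      simp
    · refine Finset.sum_congr rfl fun ℓ _ => ?_
      simp [coeffField, mul_comm]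

/-- Condition (⋆) makes the components of the flow of the truncated field into solutions of the
transport equation. -/
theorem isTransported_maxFlow (hV : IsOpen V) {X : JetField n m}
    (hX : IsLieBacklund (jetProj k ⁻¹' V) X) {r : ℕ}
    (hξ : ∀ j : Fin n, ∀ z ∈ jetProj k ⁻¹' V,
      X (Sum.inl j) z = X (Sum.inl j) (glue k (jetProj k z) 0))
    (hpoly : ∀ c, ∃ F, FibrePoly V F ∧ ∀ z ∈ jetProj k ⁻¹' V, X c z = F z)
    (hstar : StarCondition k r V X) (c : lowCoords n m k) (hc : coordOrder c.1 ≤ r) :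
    IsTransported (jetProj k ⁻¹' V) X c
      fun b => maxFlow V (truncField X k) b.2 (jetProj k b.1) c := by
  have hv : ContDiffOn ℝ ∞ (truncField X k) V :=
    contDiffOn_pi.2 fun c => (hX.smooth c).contDiffOn_glue_zero
  have hcut : Continuous (cut (lowCoords n m k)) := (cut (lowCoords n m k)).continuous
  have hcutb : ∀ b : TimeJet (Coord n m), cut (lowCoords n m k) b = (jetProj k b.1, b.2) :=
    fun b => rfl
  -- The value of `maxFlow` off its domain is also determined by the point of `J^k`, so the
  -- dependence on the coordinates of `J^k` holds everywhere.
  refine ⟨⟨lowCoords n m k, fun b b' h => ?_⟩, fun z hz => ?_, fun z hz => ?_, fun z hz => ?_⟩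
  · rw [hcutb, hcutb, Prod.mk.injEq] at h
    simp only [h.1, h.2]
  · obtain ⟨Θ, hΘ⟩ := exists_maxFlow_eq hV hv (p₀ := jetProj k z) hz
    refine SmAt.of_eventually (lowCoords n m k) (fun q => Θ q c) ?_ ?_
    · filter_upwards [hΘ] with q hq
      exact (contDiff_apply ℝ ℝ c).contDiffAt.comp q hq.1
    · filter_upwards [hcut.continuousAt.eventually hΘ] with b hb
      rw [← hb.2.2.2.2.1]
      rfl
  · obtain ⟨Θ, hΘ⟩ := exists_maxFlow_eq hV hv (p₀ := jetProj k z) hz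
    have hW := isOpen_preimage_jetProj (n := n) (m := m) hV
    filter_upwards [hcut.continuousAt.eventually (eventually_eventually_nhds.2 hΘ),
      (hW.preimage continuous_fst).mem_nhds hz] with b hb hbW
    obtain ⟨hsm, hdom, -, -, -, -, htr⟩ := hb.self_of_nhds
    have hdiff : HasFDerivAt Θ (fderiv ℝ Θ (cut (lowCoords n m k) b)) (cut (lowCoords n m k) b) :=
      (hsm.differentiableAt (by simp)).hasFDerivAt
    have hdc : HasFDerivAt (fun q => Θ q c)
        (ContinuousLinearMap.proj (R := ℝ) (φ := fun _ => ℝ) c ∘L fderiv ℝ Θ (cut (lowCoords n m k) b))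
        (cut (lowCoords n m k) b) := hasFDerivAt_pi'.1 hdiff c
    have hdd := (SmAt.hasLineDerivAt_rep (F := fun b : TimeJet (Coord n m) =>
        maxFlow V (truncField X k) b.2 (jetProj k b.1) c) (a := b) (Ψ := fun q => Θ q c) (by
      filter_upwards [hcut.continuousAt.eventually hb] with b' hb'
      rw [← hb'.2.2.2.2.1]
      rfl) hdc.differentiableAt (transportVec X b)).lineDeriv
    rw [dd, hdd, hdc.fderiv]
    obtain ⟨Λ, μ, hΛ, hsum⟩ := exists_sum_coeffField hξ hpoly hbW
    -- In `J^k`, `∂/∂t - X = ∂/∂t - X^(k) - ∑ μ_ℓ Y_ℓ`. The flow of `X^(k)` is annihilated by the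
    -- first two terms together, and by the `Y_ℓ` through (⋆).
    have hvec : cut (lowCoords n m k) (transportVec X b) = ((0 : FinJet n m k), (1 : ℝ)) -
        (truncField X k (jetProj k b.1), 0) -
        ∑ ℓ ∈ Λ, μ ℓ • (coeffField X k ℓ (jetProj k b.1), (0 : ℝ)) := by
      refine Prod.ext ?_ ?_
      · rw [Prod.fst_sub, Prod.fst_sub, Prod.fst_sum, zero_sub]
        simp only [Prod.smul_fst]
        rw [← neg_add', ← hsum]
        rfl
      · rw [Prod.snd_sub, Prod.snd_sub, Prod.snd_sum]
        simp [transportVec]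
    have hY : ∀ ℓ ∈ Λ, (fderiv ℝ Θ (cut (lowCoords n m k) b)
        (coeffField X k ℓ (jetProj k b.1), (0 : ℝ))) c = 0 := by
      intro ℓ hℓ
      have h1 := hstar ℓ (fun h => hΛ (h ▸ hℓ)) c hc (jetProj k b.1) b.2 hdom
      have h2 : HasFDerivAt (fun q => Θ (q, b.2) c)
          ((ContinuousLinearMap.proj (R := ℝ) (φ := fun _ => ℝ) c ∘L
            fderiv ℝ Θ (cut (lowCoords n m k) b)) ∘L ContinuousLinearMap.inl ℝ _ _)
          (jetProj k b.1) :=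
        HasFDerivAt.comp (jetProj k b.1) (g := fun q => Θ q c) (f := fun q => (q, b.2)) hdc
          (hasFDerivAt_prodMk_left _ _)
      have h3 : (fun q => maxFlow V (truncField X k) b.2 q c) =ᶠ[𝓝 (jetProj k b.1)]
          fun q => Θ (q, b.2) c := by
        have hcont : ContinuousAt (fun q : FinJet n m k => (q, b.2)) (jetProj k b.1) := by fun_prop
        filter_upwards [hcont.eventually hb] with q hq
        rw [← hq.2.2.2.2.1]
      rw [(h2.congr_of_eventuallyEq h3).fderiv] at h1
      exact h1
    rw [hvec, map_sub, map_sub, map_sum]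
    simp only [map_smul]
    rw [Finset.sum_eq_zero fun ℓ hℓ => by
      rw [ContinuousLinearMap.comp_apply, ContinuousLinearMap.proj_apply, hY ℓ hℓ, smul_zero],
      sub_zero, sub_eq_zero, ContinuousLinearMap.comp_apply, ContinuousLinearMap.comp_apply]
    exact congrArg _ htr
  · obtain ⟨Θ, hΘ⟩ := exists_maxFlow_eq hV hv (p₀ := jetProj k z) hz
    obtain ⟨-, -, -, h0, h1, -, -⟩ := hΘ.self_of_nhds
    change maxFlow V (truncField X k) 0 (jetProj k z) c = _
    rw [h1, h0]
    rfl

end PrincipalFlow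

/-! ### Uniqueness for the transport equation. -/

section Uniqueness

variable {n m : ℕ}

theorem continuous_extend {ι : Type*} (S : Finset ι) (z : ι → ℝ) : Continuous (extend S z) := by
  refine Continuous.prodMk (continuous_pi fun c => ?_) continuous_snd
  by_cases h : c ∈ S
  · simp only [h, dif_pos]
    fun_prop
  · simp only [h, dif_neg, not_false_iff]
    fun_prop

/-- A solution of the transport equation that vanishes at time zero vanishes for small times. -/
theorem eventually_eq_zero_of_transport {W : Set (Jet n m)} (hW : IsOpen W) {X : JetField n m}
    (hX : IsLieBacklund W X) {F : TimeJet (Coord n m) → ℝ} {z : Jet n m} (hz : z ∈ W)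
    (hF : SmAt F (z, 0))
    (hT : ∀ᶠ b in 𝓝 ((z, 0) : TimeJet (Coord n m)), dd F b (transportVec X b) = 0)
    (h0 : ∀ w ∈ W, F (w, 0) = 0) : ∀ᶠ b in 𝓝 ((z, 0) : TimeJet (Coord n m)), F b = 0 := by
  classical
  obtain ⟨S, Ψ, U, hU, hzU, hΨ, hFΨ⟩ := hF
  have hWe : ∀ᶠ b in 𝓝 ((z, 0) : TimeJet (Coord n m)), b.1 ∈ W :=
    (hW.preimage continuous_fst).mem_nhds hz
  obtain ⟨S', U', hU', hzU', hsub⟩ := exists_cut_subset (hT.and hWe)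
  obtain ⟨D, hS, hS'⟩ : ∃ D, S ⊆ D ∧ S' ⊆ D :=
    ⟨S ∪ S', Finset.subset_union_left, Finset.subset_union_right⟩
  obtain ⟨Ψ, U₁, hU₁, hzU₁, hΨ, hFΨ⟩ := SmAt.enlarge hS hU hzU hΨ hFΨ
  set U₂ := U₁ ∩ recut hS' ⁻¹' U' with hU₂def
  have hU₂ : IsOpen U₂ := hU₁.inter (hU'.preimage (recut hS').continuous)
  have hzU₂ : cut D (z, 0) ∈ U₂ := ⟨hzU₁, hzU'⟩
  -- The components of `X` along `D` may involve coordinates outside `D`; these are frozen at their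
  -- values in `z`. This loses nothing: the equation holds near `(z, 0)`, in particular at the
  -- frozen points, and `F` sees only the coordinates in `D`.
  let V : Set (D → ℝ) := {x | (extend D z (x, 0)).1 ∈ W}
  let v : (D → ℝ) → (D → ℝ) := fun x c => X c (extend D z (x, 0)).1
  have hVo : IsOpen V := hW.preimage
    (continuous_fst.comp ((continuous_extend D z).comp (by fun_prop : Continuous fun x : D → ℝ => (x, (0 : ℝ)))))
  have hx₀ : (cut D ((z, 0) : TimeJet (Coord n m))).1 ∈ V := by
    change (extend D z (cut D ((z, 0) : TimeJet (Coord n m)))).1 ∈ W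
    have := extend_cut D ((z, 0) : TimeJet (Coord n m))
    rw [this]
    exact hz
  have hv : ContDiffOn ℝ ∞ v V := by
    refine contDiffOn_pi.2 fun c => ?_
    obtain ⟨T, O, Θ, hO, hΘ, hXΘ⟩ := hX.smooth c
    have h1 : ContDiff ℝ ∞ fun x : D → ℝ => T.restrict (extend D z (x, 0)).1 :=
      contDiff_fst.comp ((contDiff_cut_extend D T z).comp (contDiff_id.prodMk contDiff_const))
    exact (hΘ.comp h1.contDiffOn fun x hx => (hXΘ _ hx).1).congr fun x hx => (hXΘ _ hx).2
  have hder : ∀ q ∈ U₂, fderiv ℝ Ψ q (-v q.1, 1) = 0 := by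
    intro q hq
    have hb : dd F (extend D z q) (transportVec X (extend D z q)) = 0 :=
      (hsub (show cut S' (extend D z q) ∈ U' by rw [← recut_cut hS', cut_extend]; exact hq.2)).1
    rw [dd_eq hU₁ (by rw [cut_extend]; exact hq.1) hΨ hFΨ, cut_extend] at hb
    exact hb
  obtain ⟨Θ, hΘ⟩ := exists_maxFlow_eq hVo hv hx₀
  set x₀ := (cut D ((z, 0) : TimeJet (Coord n m))).1 with hx₀def
  have hΘ0 := hΘ.self_of_nhds
  -- The characteristic through `(x, t)` is `s ↦ (Θ (x, s), t - s)`. Along it `Ψ` is constant, and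
  -- at `s = t` it reaches time zero.
  have hcont : ContinuousAt (fun y : ((D → ℝ) × ℝ) × ℝ => (Θ y.1, y.2 - y.1.2)) ((x₀, 0), 0) := by
    refine ContinuousAt.prodMk ?_ (by fun_prop)
    exact ContinuousAt.comp (g := Θ) hΘ0.1.continuousAt continuousAt_fst
  have hmem : ∀ᶠ y in 𝓝 (((x₀, 0), 0) : ((D → ℝ) × ℝ) × ℝ), (Θ y.1, y.2 - y.1.2) ∈ U₂ ∧
      HasDerivAt (fun s => Θ (y.1.1, s)) (v (Θ y.1)) y.1.2 := by
    refine (hcont.eventually_mem (hU₂.mem_nhds ?_)).and ?_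
    · change (Θ (x₀, 0), (0 : ℝ) - 0) ∈ U₂
      rw [hΘ0.2.2.2.1, sub_zero]
      exact hzU₂
    · filter_upwards [continuousAt_fst.eventually hΘ] with y hy using hy.2.2.2.2.2.1
  obtain ⟨ε, hε, hball⟩ := Metric.eventually_nhds_iff_ball.1 hmem
  have hfin : ∀ᶠ q in 𝓝 ((x₀, 0) : (D → ℝ) × ℝ), q ∈ U₂ ∧ Ψ q = 0 := by
    filter_upwards [Metric.ball_mem_nhds _ hε, hU₂.mem_nhds hzU₂, hΘ] with q hq hqU hqΘ
    refine ⟨hqU, ?_⟩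
    obtain ⟨x, t⟩ := q
    rw [← ball_prod_same] at hq
    have hx : x ∈ Metric.ball x₀ ε := hq.1
    have ht : t ∈ Metric.ball 0 ε := hq.2
    have hs : ∀ s ∈ Metric.ball (0 : ℝ) ε, (Θ (x, s), t - s) ∈ U₂ ∧
        HasDerivAt (fun s => Θ (x, s)) (v (Θ (x, s))) s := by
      intro s hs
      refine hball ((x, s), t) ?_
      rw [← ball_prod_same, ← ball_prod_same]
      exact ⟨⟨hx, hs⟩, ht⟩
    have hφ : ∀ s ∈ Metric.ball (0 : ℝ) ε, HasDerivAt (fun s => Ψ (Θ (x, s), t - s)) 0 s := by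
      intro s hsε
      obtain ⟨h1, h2⟩ := hs s hsε
      have h3 := (((hΨ _ h1.1).contDiffAt (hU₁.mem_nhds h1.1)).differentiableAt (by simp)).hasFDerivAt
      have h4 := h3.comp_hasDerivAt s (h2.prodMk ((hasDerivAt_id s).const_sub t))
      have h5 : fderiv ℝ Ψ (Θ (x, s), t - s) (-v (Θ (x, s)), 1) = 0 := hder _ h1
      have h6 : ((v (Θ (x, s)), -1) : (D → ℝ) × ℝ) = -(-v (Θ (x, s)), 1) := by ext <;> simp
      rw [h6] at h4
      exact (h4.congr_deriv (by rw [← neg_zero, ← h5]; exact map_neg _ _))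
    have hconst := Metric.isOpen_ball.is_const_of_deriv_eq_zero
      (convex_ball (0 : ℝ) ε).isPreconnected
      (fun s hs => (hφ s hs).differentiableAt.differentiableWithinAt)
      (fun s hs => (hφ s hs).deriv) (Metric.mem_ball_self hε) ht
    simp only [hqΘ.2.2.2.1, sub_zero, sub_self] at hconst
    rw [hconst]
    have h1 := (hs t ht).1
    rw [sub_self] at h1
    have h2 := hFΨ (extend D z (Θ (x, t), 0)) (by rw [cut_extend]; exact h1.1)
    rw [cut_extend] at h2
    rw [← h2]
    refine h0 _ ?_
    exact (hsub (show cut S' (extend D z (Θ (x, t), 0)) ∈ U' by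
      rw [← recut_cut hS', cut_extend]; exact h1.2)).2
  filter_upwards [(cut D).continuous.continuousAt.eventually hfin] with b hb
  rw [hFΨ b hb.1.1, hb.2]

end Uniqueness

/-! ### The equation of the integral curves. -/

section CurveEquation

variable {n m : ℕ} {W : Set (Jet n m)} {X : JetField n m} {G : Coord n m → TimeJet (Coord n m) → ℝ}

theorem continuousAt_family (hG : ∀ c, IsTransported W X c (G c)) {z : Jet n m} (hz : z ∈ W) :
    ContinuousAt (fun b c => G c b : TimeJet (Coord n m) → Jet n m) (z, 0) :=
  continuousAt_pi.2 fun c => ((hG c).smAt z hz).continuousAt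

theorem family_init (hG : ∀ c, IsTransported W X c (G c)) {z : Jet n m} (hz : z ∈ W) :
    (fun c => G c (z, 0)) = z := funext fun c => (hG c).init z hz

theorem eventually_family_mem (hW : IsOpen W) (hG : ∀ c, IsTransported W X c (G c)) {z : Jet n m}
    (hz : z ∈ W) : ∀ᶠ b in 𝓝 ((z, 0) : TimeJet (Coord n m)), (fun c => G c b) ∈ W :=
  (continuousAt_family hG hz).eventually_mem (hW.mem_nhds (by rwa [family_init hG hz]))

/-- Write `∂/∂t = (∂/∂t - X) + X`: the first term annihilates `F`, and the second differentiates
within the slice `t = 0`. -/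
theorem dd_time_init (hW : IsOpen W) {c : Coord n m} {F : TimeJet (Coord n m) → ℝ}
    (hF : IsTransported W X c F) {z : Jet n m} (hz : z ∈ W) : dd F (z, 0) (0, 1) = X c z := by
  have h1 : ((0, 1) : TimeJet (Coord n m)) = transportVec X (z, 0) + (fun c => X c z, 0) := by
    ext <;> simp [transportVec]
  rw [h1, (hF.smAt z hz).dd_add, (hF.transport z hz).self_of_nhds, hF.dd_init hW hz, zero_add]

/-- Solutions of the transport equation satisfy the equation of the integral curves of `X`. -/
theorem eventually_curve_equation (hW : IsOpen W) (hX : IsLieBacklund W X)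
    (hG : ∀ c, IsTransported W X c (G c)) {z : Jet n m} (hz : z ∈ W) (c : Coord n m) :
    ∀ᶠ b in 𝓝 ((z, 0) : TimeJet (Coord n m)), dd (G c) b (0, 1) = X c (fun e => G e b) := by
  obtain ⟨S, U, Ψ, hU, hΨ, hXΨ⟩ := hX.smooth c
  let Γ : TimeJet (Coord n m) → S → ℝ := fun b e => G e b
  have hcomp : ∀ᶠ b in 𝓝 ((z, 0) : TimeJet (Coord n m)),
      Γ b ∈ U ∧ X c (fun e => G e b) = Ψ (Γ b) := by
    filter_upwards [eventually_family_mem hW hG hz] with b hb using hXΨ _ hb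
  have hsG : ∀ e, SmAt (G e) (z, 0) := fun e => (hG e).smAt z hz
  have htime : ∀ a : TimeJet (Coord n m), SmFieldAt (fun _ => (0, 1)) a := fun a =>
    ⟨fun _ => smAt_const _ a, smAt_const _ a⟩
  have hΨat : ∀ x ∈ U, ContDiffAt ℝ ∞ Ψ x := fun x hx => (hΨ x hx).contDiffAt (hU.mem_nhds hx)
  have hΓ : ∀ᶠ b in 𝓝 ((z, 0) : TimeJet (Coord n m)), ∀ e : S, SmAt (G e) b :=
    eventually_all.2 fun e : S => (hsG e).eventually
  have hs1 : SmAt (fun b => dd (G c) b (0, 1)) (z, 0) := (hsG c).dd_field (htime _)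
  have hs2 : SmAt (fun b => X c (fun e => G e b)) (z, 0) := by
    refine SmAt.congr ((SmAt.pi (κ := S) fun e => hsG e).comp_left (g := Ψ) ?_)
      (hcomp.mono fun b hb => hb.2)
    filter_upwards [hU.mem_nhds hcomp.self_of_nhds.1] with x hx using hΨat x hx
  -- The difference of the two sides is itself a solution with initial value zero: `∂/∂t` commutes
  -- with `∂/∂t - X`, and the component of `X` along `c` is evaluated on functions which that
  -- derivation annihilates.
  have hzero := eventually_eq_zero_of_transport hW hX hz (hs1.sub hs2) ?_ ?_
  · filter_upwards [hzero] with b hb using sub_eq_zero.1 hb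
  · have hWe : ∀ᶠ b in 𝓝 ((z, 0) : TimeJet (Coord n m)), b.1 ∈ W :=
      (hW.preimage continuous_fst).mem_nhds hz
    have hTe : ∀ᶠ b in 𝓝 ((z, 0) : TimeJet (Coord n m)), ∀ e : S, dd (G e) b (transportVec X b) = 0 :=
      eventually_all.2 fun e : S => (hG e).transport z hz
    filter_upwards [hWe, (hsG c).eventually, hs1.eventually, hs2.eventually,
      eventually_eventually_nhds.2 ((hG c).transport z hz), eventually_eventually_nhds.2 hcomp, hΓ, hTe]
      with b hbW hb hb1 hb2 hbT hbc hbΓ hbTe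
    rw [hb1.dd_fun_sub hb2, sub_eq_zero]
    have e1 : dd (fun b => dd (G c) b (0, 1)) b (transportVec X b) = 0 := by
      have h := hb.dd_comm (smFieldAt_transportVec hW hX hbW) (htime b)
      have hbr : bracket (transportVec X) (fun _ => (0, 1)) b = 0 := by
        refine Prod.ext ?_ ?_
        · ext e
          have hXe := (hX.smooth e).smAt hW hbW b.2
          have hx0 : dd (fun b : TimeJet (Coord n m) => X e b.1) b (0, 1) = 0 := by
            simp [dd, lineDeriv]
          simp only [bracket, transportVec]
          rw [dd_const, SmAt.dd_fun_neg (F := fun b : TimeJet (Coord n m) => X e b.1) hXe, hx0]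
          simp
        · simp [bracket, transportVec, dd_const]
      rw [hbr, dd_congr (F := fun b => dd (G c) b (transportVec X b)) (G := fun _ => 0) hbT,
        dd_const, sub_zero] at h
      rw [h]
      simp [dd, lineDeriv]
    have e2 : dd (fun b => X c (fun e => G e b)) b (transportVec X b) = 0 := by
      rw [dd_congr (G := fun b => Ψ (Γ b)) (hbc.mono fun b hb => hb.2),
        (SmAt.pi (κ := S) fun e => hbΓ e).dd_comp_left
          ((hΨat _ hbc.self_of_nhds.1).differentiableAt (by simp)),
        SmAt.dd_pi (κ := S) fun e => hbΓ e]
      have : (fun e : S => dd (G e) b (transportVec X b)) = 0 := funext hbTe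
      rw [this, map_zero]
    rw [e1, e2]
  · intro w hw
    change dd (G c) (w, 0) (0, 1) - X c (fun e => G e (w, 0)) = 0
    rw [dd_time_init hW (hG c) hw, family_init hG hw, sub_self]

end CurveEquation

/-! ### Combinatorics of the finite sets of coordinates. -/

section DependenceSets

/-- Finite sets `D c` that contain prescribed ones, such that the sets `D d` with `d ∈ D c` all lie
in one set `D (g c)` with `g c ∈ D c`, where `g` takes each value finitely often. -/
theorem exists_dependence_sets {ι : Type*} [Countable ι] (R : ι → Finset ι) :
    ∃ (D : ι → Finset ι) (g : ι → ι), (∀ c, R c ⊆ D c) ∧ (∀ c, g c ∈ D c) ∧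
      (∀ c, ∀ d ∈ D c, D d ⊆ D (g c)) ∧ ∀ d, {c | g c = d}.Finite := by
  classical
  rcases finite_or_infinite ι with hι | hι
  · have := Fintype.ofFinite ι
    exact ⟨fun _ => Finset.univ, id, fun _ => Finset.subset_univ _, fun _ => Finset.mem_univ _,
      fun _ _ _ => Finset.subset_univ _, fun _ => Set.toFinite _⟩
  · obtain ⟨_⟩ := nonempty_denumerable ι
    let e : ι ≃ ℕ := Denumerable.eqv ι
    -- In an enumeration of `ι`, `N` is a strictly increasing majorant of `f`. The sets `D c` are
    -- initial segments up to `N (e c)`, and `g c` is the last element of `D c`; strict monotonicity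
    -- makes `g` injective.
    let f : ℕ → ℕ := fun j => (R (e.symm j)).sup e
    let N : ℕ → ℕ := fun j => ∑ i ∈ Finset.range (j + 1), (f i + 1)
    have hN : StrictMono N := strictMono_nat_of_lt_succ fun j => by
      simp only [N]
      rw [Finset.sum_range_succ _ (j + 1)]
      omega
    have hfN : ∀ j, f j ≤ N j := fun j =>
      (Nat.le_succ _).trans (Finset.single_le_sum (f := fun i => f i + 1) (fun _ _ => Nat.zero_le _)
        (Finset.self_mem_range_succ j))
    have hmem : ∀ c d, d ∈ (Finset.range (N (e c) + 1)).map e.symm.toEmbedding ↔ e d ≤ N (e c) := by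
      intro c d
      rw [Finset.mem_map_equiv, Finset.mem_range, Nat.lt_succ_iff]
      rfl
    refine ⟨fun c => (Finset.range (N (e c) + 1)).map e.symm.toEmbedding, fun c => e.symm (N (e c)),
      fun c d hd => ?_, fun c => ?_, fun c d hd d' hd' => ?_, fun d => ?_⟩
    · rw [hmem]
      refine le_trans ?_ (hfN _)
      simp only [f, Equiv.symm_apply_apply]
      exact Finset.le_sup (f := e) hd
    · rw [hmem, Equiv.apply_symm_apply]
    · rw [hmem] at hd hd' ⊢
      rw [Equiv.apply_symm_apply]
      exact hd'.trans (hN.monotone hd)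
    · refine Set.Subsingleton.finite fun c hc c' hc' => e.injective (hN.injective ?_)
      exact e.symm.injective (hc.trans hc'.symm)

end DependenceSets

/-! ### Regular sets, radii and guards for the domains of the flow. -/

section Domains

variable {n m : ℕ} {W : Set (Jet n m)} {X : JetField n m} {G : Coord n m → TimeJet (Coord n m) → ℝ}

/-- At `b`, the component `c` of the family `G` is a smooth function of time and of the coordinates
in `D`, and both the transport equation and the equation of the integral curves hold. -/
structure IsRegularAt (W : Set (Jet n m)) (X : JetField n m)
    (G : Coord n m → TimeJet (Coord n m) → ℝ) (D : Finset (Coord n m)) (c : Coord n m)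
    (b : TimeJet (Coord n m)) : Prop where
  mem : b.1 ∈ W
  contDiffAt : ContDiffAt ℝ ∞ (fun x => G c (extend D 0 x)) (cut D b)
  transport : dd (G c) b (transportVec X b) = 0
  family_mem : (fun e => G e b) ∈ W
  curve : dd (G c) b (0, 1) = X c fun e => G e b

theorem exists_factorsThrough_isRegularAt {K : Finset (Coord n m)}
    (hK : FactorsThrough K fun b : TimeJet (Coord n m) => b.1 ∈ W) (hX : IsLieBacklund W X)
    (hG : ∀ c, ∃ S, FactorsThrough S (G c)) (c : Coord n m) :
    ∃ R, ∀ D, R ⊆ D → FactorsThrough D (G c) ∧ FactorsThrough D (IsRegularAt W X G D c) := by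
  classical
  choose T hT using hG
  choose S U Ψ hU hΨ hS using hX.smooth
  have hXeq : ∀ e, ∀ z ∈ W, ∀ z' ∈ W, (∀ d ∈ S e, z d = z' d) → X e z = X e z' := by
    intro e z hz z' hz' h
    rw [(hS e z hz).2, (hS e z' hz').2]
    congr 1
    ext d
    exact h d d.2
  -- In this order, the sets account for `b.1 ∈ W`, for `G c`, for the components of `X` in the
  -- transport equation of `G c`, for `X c` evaluated on the family, and for the family lying in
  -- `W`.
  refine ⟨K ∪ T c ∪ (T c).biUnion S ∪ (S c).biUnion T ∪ K.biUnion T, fun D hD => ?_⟩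
  simp only [Finset.union_subset_iff, Finset.biUnion_subset] at hD
  obtain ⟨⟨⟨⟨hKD, hTD⟩, hTS⟩, hST⟩, hKT⟩ := hD
  refine ⟨(hT c).mono hTD, ?_⟩
  have key : ∀ b b' : TimeJet (Coord n m), cut D b = cut D b' → IsRegularAt W X G D c b →
      IsRegularAt W X G D c b' := by
    intro b b' h hb
    have hWb : (b.1 ∈ W) = (b'.1 ∈ W) := hK.mono hKD b b' h
    have hW' : b'.1 ∈ W := hWb ▸ hb.mem
    have hfam : ((fun e => G e b) ∈ W) = ((fun e => G e b') ∈ W) := by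
      refine hK (fun e => G e b, 0) (fun e => G e b', 0) (Prod.ext ?_ rfl)
      ext e
      exact (hT e).mono (hKT e e.2) b b' h
    have hfam' : (fun e => G e b') ∈ W := hfam ▸ hb.family_mem
    have hcutT : cut (T c) b = cut (T c) b' := by rw [← recut_cut hTD, h, recut_cut]
    refine ⟨hW', h ▸ hb.contDiffAt, ?_, hfam', ?_⟩
    · rw [← hb.transport]
      refine (hT c).dd hcutT.symm (Prod.ext ?_ rfl)
      ext e
      have : X e b'.1 = X e b.1 := hXeq e _ hW' _ hb.mem fun d hd =>
        (congrFun (congrArg Prod.fst h) ⟨d, hTS e e.2 hd⟩).symm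
      simp [transportVec, this]
    · rw [hXeq c _ hfam' _ hb.family_mem fun d hd => ((hT d).mono (hST d hd) b b' h).symm, ← hb.curve]
      exact (hT c).dd hcutT.symm rfl
  exact fun b b' h => propext ⟨key b b' h, key b' b h.symm⟩

theorem eventually_isRegularAt (hW : IsOpen W) (hX : IsLieBacklund W X)
    (hG : ∀ c, IsTransported W X c (G c)) {D : Finset (Coord n m)} {c : Coord n m}
    (hD : FactorsThrough D (G c)) {z : Jet n m} (hz : z ∈ W) :
    ∀ᶠ b in 𝓝 ((z, 0) : TimeJet (Coord n m)), IsRegularAt W X G D c b := by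
  filter_upwards [(hW.preimage continuous_fst).mem_nhds hz, ((hG c).smAt z hz).eventually,
    (hG c).transport z hz, eventually_family_mem hW hG hz, eventually_curve_equation hW hX hG hz c]
    with b h1 h2 h3 h4 h5
  exact ⟨h1, h2.contDiffAt_of_factorsThrough hD 0, h3, h4, h5⟩

/-- An open set of values of the coordinates in `D` and of time where the component `c` is
regular. -/
def regularSet (W : Set (Jet n m)) (X : JetField n m) (G : Coord n m → TimeJet (Coord n m) → ℝ)
    (D : Finset (Coord n m)) (c : Coord n m) : Set ((D → ℝ) × ℝ) :=
  interior {x | IsRegularAt W X G D c (extend D 0 x)} ∩ {x | |x.2| < 1}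

theorem isOpen_regularSet (D : Finset (Coord n m)) (c : Coord n m) :
    IsOpen (regularSet W X G D c) :=
  isOpen_interior.inter (isOpen_lt continuous_snd.abs continuous_const)

theorem isRegularAt_of_mem {D : Finset (Coord n m)} {c : Coord n m}
    (hD : FactorsThrough D (IsRegularAt W X G D c)) {b : TimeJet (Coord n m)}
    (hb : cut D b ∈ regularSet W X G D c) : IsRegularAt W X G D c b := by
  have h := interior_subset hb.1
  rwa [Set.mem_ofPred_eq, hD _ b (cut_extend D 0 (cut D b))] at h

/-- A property that depends on finitely many coordinates and holds near a point holds near its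
projection. -/
theorem FactorsThrough.eventually_extend {ι : Type*} {D : Finset ι} {P : TimeJet ι → Prop}
    (hD : FactorsThrough D P) {a : TimeJet ι} (h : ∀ᶠ b in 𝓝 a, P b) (z : ι → ℝ) :
    ∀ᶠ x in 𝓝 (cut D a), P (extend D z x) := by
  have h1 : ContinuousAt (extend D a.1) (cut D a) := (continuous_extend D a.1).continuousAt
  rw [← extend_cut D a] at h
  filter_upwards [h1.eventually h] with x hx
  rwa [hD _ (extend D a.1 x) (by rw [cut_extend, cut_extend])]

theorem eventually_mem_regularSet (hW : IsOpen W) (hX : IsLieBacklund W X)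
    (hG : ∀ c, IsTransported W X c (G c)) {D : Finset (Coord n m)} {c : Coord n m}
    (hD : FactorsThrough D (G c)) (hD' : FactorsThrough D (IsRegularAt W X G D c)) {z : Jet n m}
    (hz : z ∈ W) : cut D (z, 0) ∈ regularSet W X G D c :=
  ⟨mem_interior_iff_mem_nhds.2
    (hD'.eventually_extend (eventually_isRegularAt hW hX hG hD hz) 0), by simp⟩

/-- The distance of a point at time zero to the complement of the regular set. -/
def radius (W : Set (Jet n m)) (X : JetField n m) (G : Coord n m → TimeJet (Coord n m) → ℝ)
    (D : Finset (Coord n m)) (c : Coord n m) (p : D → ℝ) : ℝ :=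
  Metric.infDist (p, (0 : ℝ)) (regularSet W X G D c)ᶜ

theorem continuous_radius (D : Finset (Coord n m)) (c : Coord n m) :
    Continuous (radius W X G D c) :=
  (Metric.continuous_infDist_pt _).comp (by fun_prop)

/-- The bound `|t| < 1` in the regular set serves this purpose: `Metric.infDist` to the empty set is
zero, so the radius would be useless if the complement were empty. -/
theorem nonempty_compl_regularSet (D : Finset (Coord n m)) (c : Coord n m) :
    (regularSet W X G D c)ᶜ.Nonempty :=
  ⟨(0, 2), fun h => by
    have := h.2
    norm_num at this⟩

theorem radius_pos {D : Finset (Coord n m)} {c : Coord n m} {p : D → ℝ}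
    (h : (p, (0 : ℝ)) ∈ regularSet W X G D c) : 0 < radius W X G D c p :=
  ((isOpen_regularSet D c).isClosed_compl.notMem_iff_infDist_pos
    (nonempty_compl_regularSet D c)).1 (not_not.2 h)

theorem mem_regularSet_of_dist_lt {D : Finset (Coord n m)} {c : Coord n m} {p q : D → ℝ} {t : ℝ}
    (hq : dist q p < radius W X G D c p) (ht : |t| < radius W X G D c p) :
    (q, t) ∈ regularSet W X G D c := by
  refine Metric.ball_infDist_compl_subset (x := (p, (0 : ℝ))) ?_
  rw [Metric.mem_ball, Prod.dist_eq]
  refine max_lt hq ?_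
  rw [dist_zero_right, Real.norm_eq_abs]
  exact ht

/-- The curve through `b` stays up to the time of `b` in the regular sets of the components in
`D c`, and in a ball about its initial point that lies in the regular set of the component `c`. -/
def IsGuarded (W : Set (Jet n m)) (X : JetField n m) (G : Coord n m → TimeJet (Coord n m) → ℝ)
    (D : Coord n m → Finset (Coord n m)) (c : Coord n m) (b : TimeJet (Coord n m)) : Prop :=
  |b.2| < radius W X G (D c) c (cut (D c) b).1 / 2 ∧
    ∀ s, |s| ≤ |b.2| → ∀ d ∈ D c, cut (D d) (b.1, s) ∈ regularSet W X G (D d) d ∧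
      |G d (b.1, s) - b.1 d| < radius W X G (D c) c (cut (D c) b).1

/-- The radius reads the coordinates in `D c`, while following the components `d ∈ D c` along the
curve reads those in `D d`. -/
theorem factorsThrough_isGuarded {D : Coord n m → Finset (Coord n m)} {c c' : Coord n m}
    (hD : ∀ d, FactorsThrough (D d) (G d)) (hc : D c ⊆ D c') (hc' : ∀ d ∈ D c, D d ⊆ D c') :
    FactorsThrough (D c') (IsGuarded W X G D c) := by
  have key : ∀ b b' : TimeJet (Coord n m), cut (D c') b = cut (D c') b' → IsGuarded W X G D c b →
      IsGuarded W X G D c b' := by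
    intro b b' h hb
    have h1 : (cut (D c') b).1 = (cut (D c') b').1 := by rw [h]
    have h2 : (cut (D c') b).2 = (cut (D c') b').2 := by rw [h]
    rw [cut_apply_snd, cut_apply_snd] at h2
    have hcutc : cut (D c) b = cut (D c) b' := by rw [← recut_cut hc, h, recut_cut]
    have hs : ∀ s : ℝ, cut (D c') (b.1, s) = cut (D c') (b'.1, s) := fun s =>
      Prod.ext h1 rfl
    have hcut : ∀ d ∈ D c, ∀ s, cut (D d) (b.1, s) = cut (D d) (b'.1, s) := fun d hd s => by
      rw [← recut_cut (hc' d hd), hs, recut_cut]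
    refine ⟨by rw [← h2, ← hcutc]; exact hb.1, fun s hsb d hd => ?_⟩
    obtain ⟨h3, h4⟩ := hb.2 s (by rwa [h2]) d hd
    rw [hcut d hd] at h3
    have h5 : b.1 d = b'.1 d := congrFun (congrArg Prod.fst hcutc) ⟨d, hd⟩
    rw [hD d _ _ (hcut d hd s), hcutc, h5] at h4
    exact ⟨h3, h4⟩
  exact fun b b' h => propext ⟨key b b' h, key b' b h.symm⟩

theorem eventually_isGuarded (hW : IsOpen W) (hX : IsLieBacklund W X)
    (hG : ∀ c, IsTransported W X c (G c)) {D : Coord n m → Finset (Coord n m)}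
    (hD : ∀ d, FactorsThrough (D d) (G d))
    (hD' : ∀ d, FactorsThrough (D d) (IsRegularAt W X G (D d) d)) (c : Coord n m) {z : Jet n m}
    (hz : z ∈ W) : ∀ᶠ b in 𝓝 ((z, 0) : TimeJet (Coord n m)), IsGuarded W X G D c b := by
  have hmem : ∀ d, cut (D d) (z, 0) ∈ regularSet W X G (D d) d := fun d =>
    eventually_mem_regularSet hW hX hG (hD d) (hD' d) hz
  have hrad : Continuous fun b : TimeJet (Coord n m) =>
      radius W X G (D c) c (cut (D c) b).1 :=
    (continuous_radius _ _).comp (continuous_fst.comp (cut (D c)).continuous)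
  have hpos : 0 < radius W X G (D c) c (cut (D c) ((z, 0) : TimeJet (Coord n m))).1 :=
    radius_pos (hmem c)
  have hall : ∀ᶠ b in 𝓝 ((z, 0) : TimeJet (Coord n m)), ∀ d : D c,
      cut (D d) b ∈ regularSet W X G (D d) d ∧
      |G d b - b.1 d| < radius W X G (D c) c (cut (D c) b).1 := by
    refine eventually_all.2 fun d => ?_
    refine ((cut (D d)).continuous.continuousAt.eventually_mem
      ((isOpen_regularSet _ _).mem_nhds (hmem d))).and ?_
    have h1 : ContinuousAt (fun b : TimeJet (Coord n m) => |G d b - b.1 d|) (z, 0) :=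
      (((hG d).smAt z hz).sub (smAt_coord d.1 _)).continuousAt.abs
    refine h1.eventually_lt hrad.continuousAt ?_
    rw [(hG d).init z hz]
    simpa using hpos
  have htime : ∀ᶠ b in 𝓝 ((z, 0) : TimeJet (Coord n m)),
      |b.2| < radius W X G (D c) c (cut (D c) b).1 / 2 := by
    refine ContinuousAt.eventually_lt (by fun_prop) (hrad.div_const 2).continuousAt ?_
    simpa using hpos
  have hunif : ∀ᶠ b in 𝓝 ((z, 0) : TimeJet (Coord n m)), ∀ s, |s| ≤ |b.2| → ∀ d : D c,
      cut (D d) (b.1, s) ∈ regularSet W X G (D d) d ∧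
      |G d (b.1, s) - b.1 d| < radius W X G (D c) c (cut (D c) b).1 := by
    -- A product neighbourhood with a symmetric interval of times contains, with each time `t`, all
    -- `s` with `|s| ≤ |t|`.
    rw [nhds_prod_eq] at hall ⊢
    obtain ⟨p, hp, q, hq, hpq⟩ := eventually_prod_iff.1 hall
    obtain ⟨ε, hε, hball⟩ := Metric.eventually_nhds_iff_ball.1 hq
    refine eventually_prod_iff.2 ⟨p, hp, fun t => t ∈ Metric.ball 0 ε, Metric.ball_mem_nhds _ hε, ?_⟩
    intro x hx t ht s hs
    refine hpq hx (hball s ?_)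
    rw [mem_ball_zero_iff, Real.norm_eq_abs] at ht ⊢
    exact hs.trans_lt ht
  filter_upwards [htime, hunif] with b h1 h2
  exact ⟨h1, fun s hs d hd => h2 s hs ⟨d, hd⟩⟩

end Domains

/-! ### The group law and the construction of the flow. -/

section GroupLaw

theorem FactorsThrough.apply_cut {ι β : Type*} {D : Finset ι} {F : TimeJet ι → β}
    (hF : FactorsThrough D F) (b : TimeJet ι) (z : ι → ℝ) : F (extend D z (cut D b)) = F b :=
  hF _ b (cut_extend D z (cut D b))

theorem FactorsThrough.dd_eq_fderiv {ι : Type*} {D : Finset ι} {F : TimeJet ι → ℝ}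
    (hF : FactorsThrough D F) {b : TimeJet ι} {z : ι → ℝ}
    (hd : DifferentiableAt ℝ (fun x => F (extend D z x)) (cut D b)) (v : TimeJet ι) :
    LieBacklund.dd F b v = fderiv ℝ (fun x => F (extend D z x)) (cut D b) (cut D v) :=
  (SmAt.hasLineDerivAt_rep (Eventually.of_forall fun b => (hF.apply_cut b z).symm) hd v).lineDeriv

variable {n m : ℕ} {W : Set (Jet n m)} {X : JetField n m} {G : Coord n m → TimeJet (Coord n m) → ℝ}

theorem IsRegularAt.hasDerivAt {D : Finset (Coord n m)} {c : Coord n m} {z : Jet n m} {r : ℝ}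
    (hD : FactorsThrough D (G c)) (h : IsRegularAt W X G D c (z, r)) :
    HasDerivAt (fun r => G c (z, r)) (X c fun e => G e (z, r)) r := by
  have hd := h.contDiffAt.differentiableAt (by simp)
  have h1 : HasDerivAt (fun r : ℝ => cut D ((z, r) : TimeJet (Coord n m)))
      (cut D ((0, 1) : TimeJet (Coord n m))) r := by
    have := (hasDerivAt_const r (D.restrict z)).prodMk (hasDerivAt_id r)
    exact this
  have h2 := hd.hasFDerivAt.comp_hasDerivAt r h1
  rw [← hD.dd_eq_fderiv hd, h.curve] at h2
  exact h2.congr_of_eventuallyEq (Eventually.of_forall fun r => (hD.apply_cut (z, r) 0).symm)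

/-- The group law for the solutions of the transport equation. -/
theorem family_add (hG : ∀ c, IsTransported W X c (G c)) {D : Coord n m → Finset (Coord n m)}
    (hD : ∀ d, FactorsThrough (D d) (G d))
    (hD' : ∀ d, FactorsThrough (D d) (IsRegularAt W X G (D d) d)) {c : Coord n m} {z : Jet n m}
    (hz : z ∈ W) {s t : ℝ} (hs : IsGuarded W X G D c (z, s))
    (hts : |t + s| < radius W X G (D c) c ((D c).restrict z) / 2) :
    G c (fun e => G e (z, s), t) = G c (z, t + s) := by
  set ρ := radius W X G (D c) c ((D c).restrict z) with hρ
  obtain ⟨hs1, hs2⟩ := hs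
  change |s| < ρ / 2 at hs1
  have hρpos : 0 < ρ := by linarith [abs_nonneg s]
  -- The point `G(z, r)` moves with velocity `X` while the remaining time decreases, so the argument
  -- of `G c` moves along `-(∂/∂t - X)`. The guard keeps it in the regular set of `c`: the point is
  -- within `ρ` of `z` in the coordinates of `D c`, and `|t + s - r| ≤ |t + s| + |r| < ρ / 2 + ρ /
  -- 2`.
  have hder : ∀ r ∈ uIcc 0 s,
      HasDerivAt (fun r => G c (fun e => G e (z, r), t + s - r)) 0 r := by
    intro r hr
    have hrs : |r| ≤ |s| := by simpa using abs_sub_left_of_mem_uIcc hr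
    have hmem : cut (D c) ((fun e => G e (z, r), t + s - r) : TimeJet (Coord n m)) ∈
        regularSet W X G (D c) c := by
      refine mem_regularSet_of_dist_lt (p := (D c).restrict z) ?_ ?_
      · refine (dist_pi_lt_iff hρpos).2 fun d => ?_
        rw [Real.dist_eq]
        exact (hs2 r hrs d d.2).2
      · have := abs_sub (t + s) r
        change |t + s - r| < ρ
        linarith
    have hb := isRegularAt_of_mem (hD' c) hmem
    have hd := hb.contDiffAt.differentiableAt (by simp)
    have h1 : HasDerivAt (fun r => cut (D c) ((fun e => G e (z, r), t + s - r) : TimeJet (Coord n m)))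
        (-cut (D c) (transportVec X (fun e => G e (z, r), t + s - r))) r := by
      have h2 : HasDerivAt (fun r => fun d : D c => G d (z, r))
          (fun d : D c => X d fun e => G e (z, r)) r :=
        hasDerivAt_pi.2 fun d => (isRegularAt_of_mem (hD' d) (hs2 r hrs d d.2).1).hasDerivAt (hD d)
      refine (h2.prodMk ((hasDerivAt_id r).const_sub (t + s))).congr_deriv ?_
      ext <;> simp [transportVec]
    have h3 := hd.hasFDerivAt.comp_hasDerivAt r h1
    rw [map_neg, ← (hD c).dd_eq_fderiv hd, hb.transport, neg_zero] at h3
    exact h3.congr_of_eventuallyEq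
      (Eventually.of_forall fun r => ((hD c).apply_cut (fun e => G e (z, r), t + s - r) 0).symm)
  have hconst := (convex_uIcc 0 s).norm_image_sub_le_of_norm_hasDerivWithin_le
    (fun r hr => (hder r hr).hasDerivWithinAt) (fun _ _ => norm_zero.le) left_mem_uIcc right_mem_uIcc
  rw [zero_mul, norm_le_zero_iff, sub_eq_zero] at hconst
  simpa [family_init hG hz] using hconst

/-- The local map with components `G c`, on the points where they are guarded. -/
def transportFlow (W : Set (Jet n m)) (X : JetField n m)
    (G : Coord n m → TimeJet (Coord n m) → ℝ) (D : Coord n m → Finset (Coord n m))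
    (g : Coord n m → Coord n m) : FlowData n m where
  dep := D
  dom c := {x | |x.2| < radius W X G (D c) c x.1 / 2} ∩
    interior {x | ∀ c', g c' = c → IsGuarded W X G D c' (extend (D c) 0 x)}
  val c x := G c (extend (D c) 0 x)

/-- A field with solutions of the transport equation for all coordinates is exponentiable. -/
theorem exponentiable_of_isTransported (hW : IsOpen W) {K : Finset (Coord n m)}
    (hK : FactorsThrough K fun b : TimeJet (Coord n m) => b.1 ∈ W) (hX : IsLieBacklund W X)
    (hG : ∀ c, IsTransported W X c (G c)) : Exponentiable W X := by
  choose R hR using exists_factorsThrough_isRegularAt hK hX fun c => (hG c).factors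
  classical
  obtain ⟨D, g, hRD', hgD, hDg, hfin⟩ := exists_dependence_sets fun c => insert c (R c)
  have hRD : ∀ c, R c ⊆ D c := fun c => (Finset.subset_insert _ _).trans (hRD' c)
  have hself : ∀ c, c ∈ D c := fun c => hRD' c (Finset.mem_insert_self _ _)
  have hD : ∀ d, FactorsThrough (D d) (G d) := fun d => (hR d _ (hRD d)).1
  have hD' : ∀ d, FactorsThrough (D d) (IsRegularAt W X G (D d) d) := fun d => (hR d _ (hRD d)).2
  have hguard : ∀ c, FactorsThrough (D (g c)) (IsGuarded W X G D c) := fun c =>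
    factorsThrough_isGuarded hD (hDg c c (hself c)) (hDg c)
  have hmap : ∀ t z, (transportFlow W X G D g).map t z = fun c => G c (z, t) := fun t z =>
    funext fun c => (hD c).apply_cut (z, t) 0
  refine ⟨transportFlow W X G D g, fun c => ?_, fun c x hx => ?_, fun z hz c => ?_, fun z hz => ?_,
    fun z hz c => ?_, fun z hz c s t h1 h2 h3 => ?_⟩
  · exact (isOpen_lt (by fun_prop) (((continuous_radius _ _).comp continuous_fst).div_const 2)).inter
      isOpen_interior
  · have hmem : x ∈ regularSet W X G (D c) c := by
      have h1 : |x.2| < radius W X G (D c) c x.1 / 2 := hx.1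
      have h2 := abs_nonneg x.2
      have h3 : |x.2| < radius W X G (D c) c x.1 := by linarith
      exact mem_regularSet_of_dist_lt ((dist_self x.1).trans_lt (h2.trans_lt h3)) h3
    have h : x ∈ {x | IsRegularAt W X G (D c) c (extend (D c) 0 x)} := interior_subset hmem.1
    have h4 := (cut_extend (D c) 0 x ▸ h.contDiffAt :
      ContDiffAt ℝ ∞ (fun x => G c (extend (D c) 0 x)) x)
    exact h4.contDiffWithinAt
  · refine ⟨?_, mem_interior_iff_mem_nhds.2 ?_⟩
    · change |(0 : ℝ)| < _
      rw [abs_zero]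
      exact half_pos (radius_pos (eventually_mem_regularSet hW hX hG (hD c) (hD' c) hz))
    -- The component `c` carries the guards of all `c'` with `g c' = c`; there are finitely many, so
    -- they hold together on a neighbourhood.
    · have h : ∀ c' ∈ {c' | g c' = c}, ∀ᶠ x in 𝓝 (cut (D c) ((z, 0) : TimeJet (Coord n m))),
          IsGuarded W X G D c' (extend (D c) 0 x) := by
        rintro c' rfl
        exact (hguard c').eventually_extend (eventually_isGuarded hW hX hG hD hD' c' hz) 0
      exact (eventually_all_finite (hfin c)).2 h
  · rw [hmap, family_init hG hz]
  · simp only [hmap]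
    have h := ((hG c).smAt z hz).hasLineDerivAt (0, 1)
    rw [dd_time_init hW (hG c) hz] at h
    simpa [HasLineDerivAt] using h
  · simp only [hmap]
    refine family_add hG hD hD' hz ?_ h3.1
    -- Since `g c ∈ D c`, definedness of `Φ_s(z)` on `D c` includes the component `g c`, whose
    -- domain contains the guard of `c`.
    have h4 := (interior_subset (h1 (g c) (hgD c)).2) c rfl
    exact cast ((hguard c).apply_cut (z, s) 0) h4

end GroupLaw

/-! ### Reduction of the theorem to the construction of the flow. -/

section Exponentiability

variable {n m k : ℕ}

/-- Functions that depend only on the coordinates in `A`, besides the `x_i`, depend only on the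
coordinates of order at most `k`. -/
theorem eq_glue_zero_of_partialD {A : Finset (Multipair n m)} (hk : setOrder A ≤ k)
    {V : Set (FinJet n m k)} (hV : IsOpen V) {F : Jet n m → ℝ}
    (hF : IsSmoothOn (jetProj k ⁻¹' V) F)
    (h0 : ∀ q ∉ A, ∀ z ∈ jetProj k ⁻¹' V, partialD (Sum.inr q) F z = 0) {z : Jet n m}
    (hz : z ∈ jetProj k ⁻¹' V) : F z = F (glue k (jetProj k z) 0) := by
  refine eq_glue_zero hV hF (fun c hc => ?_) hz
  rcases c with i | q
  · exact absurd (mem_lowCoords.2 (Nat.zero_le k)) hc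
  · exact h0 q fun hq => hc (mem_lowCoords.2 ((coordOrder_le_of_mem hq).trans hk))

/-- Exponentiability follows from condition (⋆) in any order `k ≥ |A|` for the components of any
order `r`. -/
theorem exponentiable_of_starCondition {A : Finset (Multipair n m)} (hk : setOrder A ≤ k)
    {V : Set (FinJet n m k)} (hV : IsOpen V) {X : JetField n m}
    (hX : IsLieBacklund (jetProj k ⁻¹' V) X)
    (hA : principalSupport (jetProj k ⁻¹' V) X ⊆ ↑A) {r : ℕ} (hstar : StarCondition k r V X) :
    Exponentiable (jetProj k ⁻¹' V) X := by
  have hW : IsOpen (jetProj k ⁻¹' V : Set (Jet n m)) := isOpen_preimage_jetProj hV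
  have hξ : ∀ j : Fin n, ∀ z ∈ jetProj k ⁻¹' V,
      X (Sum.inl j) z = X (Sum.inl j) (glue k (jetProj k z) 0) := fun j z hz =>
    eq_glue_zero_of_partialD hk hV (hX.smooth _)
      (fun q hq w hw => by_contra fun h => hq (hA (Or.inl ⟨j, w, hw, h⟩))) hz
  have hη : ∀ L : Fin m, ∀ z ∈ jetProj k ⁻¹' V,
      X (Sum.inr (L, 0)) z = X (Sum.inr (L, 0)) (glue k (jetProj k z) 0) := fun L z hz =>
    eq_glue_zero_of_partialD hk hV (hX.smooth _)
      (fun q hq w hw => by_contra fun h => hq (hA (Or.inr ⟨L, w, hw, h⟩))) hz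
  -- Only components of order zero are taken from the flow in `J^k`; prolongation supplies all the
  -- others.
  have hprincipal : ∀ c : Coord n m, coordOrder c = 0 → ∃ G, IsTransported (jetProj k ⁻¹' V) X c G :=
    fun c hc => ⟨_, isTransported_maxFlow hV hX hξ (hX.exists_fibrePoly hV hξ hη) hstar
      ⟨c, mem_lowCoords.2 (hc.trans_le (Nat.zero_le k))⟩ (hc.trans_le (Nat.zero_le r))⟩
  choose G hG using exists_isTransported hW hX (fun l => hprincipal (Sum.inl l) rfl)
    fun L => hprincipal (Sum.inr (L, 0)) (by simp [coordOrder, len])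
  refine exponentiable_of_isTransported hW (K := lowCoords n m k) (fun b b' h => ?_) hX hG
  have h1 : jetProj k b.1 = jetProj k b'.1 := congrArg Prod.fst h
  simp only [mem_preimage, h1]

end Exponentiability

end LieBacklund

end

theorem theorem6 (n m : ℕ) (A : Finset (LieBacklund.Multipair n m))
    (k : ℕ) (hk : k = 2 * LieBacklund.setOrder A)
    (V : Set (LieBacklund.FinJet n m k)) (hV : IsOpen V)
    (X : LieBacklund.JetField n m)
    (hX : LieBacklund.IsLieBacklund (LieBacklund.jetProj k ⁻¹' V) X)
    (hA : LieBacklund.principalSupport (LieBacklund.jetProj k ⁻¹' V) X ⊆ ↑A)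
    (hstar : LieBacklund.StarCondition k (LieBacklund.setOrder A) V X) :
    LieBacklund.Exponentiable (LieBacklund.jetProj k ⁻¹' V) X := by
  exact LieBacklund.exponentiable_of_starCondition (by omega) hV hX hA hstar
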